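/- Let $R$ be an integral domain with units $q,\lambda,x,q_0$ and elements $q_1,A$, such that $\delta:=q-q^{-1}$ is invertible and $x\delta=\delta-\lambda+\lambda^{-1}$. For $n\ge 1$ let ${\rm BB}_n$ be the unital associative $R$-algebra generated by invertible elements $Y,X_1,\dots,X_{n-1}$ subject to the following relations, where $e_i:=1-\delta^{-1}(X_i-X_i^{-1})$: $$X_iX_j=X_jX_i\ (|i-j|>1),\qquad X_iX_jX_i=X_jX_iX_j\ (|i-j|=1),$$ $$X_ie_i=e_iX_i=\lambda e_i,\qquad e_iX_{i-1}^{\pm1}e_i=\lambda^{\mp1}e_i,$$ $$X_1YX_1Y=YX_1YX_1,\quad Y^2=q_1Y+q_0,\quad YX_1Ye_1=e_1,\quad YX_i=X_iY\ (i>1),\quad e_1Ye_1=Ae_1 .$$ Put ${\rm BB}_0:=R$. Elements of ${\rm BB}_m$ are regarded as elements of ${\rm BB}_{m+1}$ through the canonical homomorphism that sends each generator to the generator of the same name. Let $n\ge1$ and assume that for every $0\le m\le n$ the map ${\rm BB}_m\to{\rm BB}_{m+2}$, $a\mapsto x^{-1}ae_{m+1}$, is injective. Then for every $0\le m\le n$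 the conditional expectation $\epsilon_m:{\rm BB}_{m+1}\to{\rm BB}_m$ is well defined by $$e_{m+1}\,a\,e_{m+1}=x\,\epsilon_m(a)\,e_{m+1}\quad\text{in }{\rm BB}_{m+2},$$ that is, for each $a$ there is exactly one such $\epsilon_m(a)$. Let ${\rm tr}:{\rm BB}_{m+1}\to R$, $0\le m\le n$, be defined recursively by ${\rm tr}(a):={\rm tr}(\epsilon_m(a))$, starting from the identity map on ${\rm BB}_0=R$. Let $I_{n+1}$ be the two-sided ideal of ${\rm BB}_{n+1}$ generated by $e_n$. Assume that $I_{n+1}$ is semisimple (that is, isomorphic as a ring to a semisimple ring) and that ${\rm tr}$ is a trace on ${\rm BB}_n$, i.e. an $R$-linear functional with ${\rm tr}(ab)={\rm tr}(ba)$ for all $a,b\in{\rm BB}_n$. Then ${\rm tr}$ is a trace on ${\rm BB}_{n+1}$. -/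

import Mathlib

universe u

/-- Parameters of the reduced B-type Birman-Murakami-Wenzl algebra over `R`: units
`q, lam, x, q0` and elements `q1, A`, such that `del = q - q⁻¹` is invertible and
`x * del = del - lam + lam⁻¹`. -/
structure BBParams (R : Type u) [CommRing R] where
  q : Rˣ
  lam : Rˣ
  x : Rˣ
  q0 : Rˣ
  del : Rˣ
  q1 : R
  A : R
  del_eq : (del : R) = (q : R) - ((q⁻¹ : Rˣ) : R)
  x_mul_del : (x : R) * (del : R) = (del : R) - (lam : R) + ((lam⁻¹ : Rˣ) : R)

/-- The letters for `n` strands: `Y` and its inverse (as soon as `1 ≤ n`), and `X_i` and its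
inverse for `1 ≤ i ≤ n - 1`. There are no letters for `n = 0`. -/
inductive BBGen (n : ℕ) : Type
  | Y (h : 1 ≤ n) : BBGen n
  | Yinv (h : 1 ≤ n) : BBGen n
  | X (i : ℕ) (h : 1 ≤ i ∧ i < n) : BBGen n
  | Xinv (i : ℕ) (h : 1 ≤ i ∧ i < n) : BBGen n

noncomputable section

namespace BBFree

variable {R : Type u} [CommRing R] (p : BBParams R) {n : ℕ}

/-- The letter `Y` in the free algebra. -/
def Y (R : Type u) [CommRing R] {n : ℕ} (h : 1 ≤ n) : FreeAlgebra R (BBGen n) :=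
  FreeAlgebra.ι R (BBGen.Y h)

/-- The letter `Y⁻¹` in the free algebra. -/
def Yinv (R : Type u) [CommRing R] {n : ℕ} (h : 1 ≤ n) : FreeAlgebra R (BBGen n) :=
  FreeAlgebra.ι R (BBGen.Yinv h)

/-- The letter `X_i` in the free algebra. -/
def X (R : Type u) [CommRing R] {n : ℕ} (i : ℕ) (h : 1 ≤ i ∧ i < n) :
    FreeAlgebra R (BBGen n) :=
  FreeAlgebra.ι R (BBGen.X i h)

/-- The letter `X_i⁻¹` in the free algebra. -/
def Xinv (R : Type u) [CommRing R] {n : ℕ} (i : ℕ) (h : 1 ≤ i ∧ i < n) :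
    FreeAlgebra R (BBGen n) :=
  FreeAlgebra.ι R (BBGen.Xinv i h)

/-- `e_i = 1 - (X_i - X_i⁻¹) / del` in the free algebra. -/
def e (i : ℕ) (h : 1 ≤ i ∧ i < n) : FreeAlgebra R (BBGen n) :=
  1 - ((p.del⁻¹ : Rˣ) : R) • (X R i h - Xinv R i h)

end BBFree

open BBFree in
/-- The defining relations of the algebra on `n` strands. -/
inductive BBRel {R : Type u} [CommRing R] (p : BBParams R) (n : ℕ) :
    FreeAlgebra R (BBGen n) → FreeAlgebra R (BBGen n) → Prop
  | Y_mul_Yinv (h : 1 ≤ n) : BBRel p n (Y R h * Yinv R h) 1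
  | Yinv_mul_Y (h : 1 ≤ n) : BBRel p n (Yinv R h * Y R h) 1
  | X_mul_Xinv (i : ℕ) (h : 1 ≤ i ∧ i < n) : BBRel p n (X R i h * Xinv R i h) 1
  | Xinv_mul_X (i : ℕ) (h : 1 ≤ i ∧ i < n) : BBRel p n (Xinv R i h * X R i h) 1
  | X_comm (i j : ℕ) (hi : 1 ≤ i ∧ i < n) (hj : 1 ≤ j ∧ j < n) (hij : i + 1 < j) :
      BBRel p n (X R i hi * X R j hj) (X R j hj * X R i hi)
  | X_braid (i : ℕ) (hi : 1 ≤ i ∧ i < n) (hj : 1 ≤ i + 1 ∧ i + 1 < n) :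
      BBRel p n (X R i hi * X R (i + 1) hj * X R i hi)
        (X R (i + 1) hj * X R i hi * X R (i + 1) hj)
  | X_mul_e (i : ℕ) (h : 1 ≤ i ∧ i < n) : BBRel p n (X R i h * e p i h) ((p.lam : R) • e p i h)
  | e_mul_X (i : ℕ) (h : 1 ≤ i ∧ i < n) : BBRel p n (e p i h * X R i h) ((p.lam : R) • e p i h)
  | e_X_e (i : ℕ) (hi : 1 ≤ i ∧ i < n) (hj : 1 ≤ i + 1 ∧ i + 1 < n) :
      BBRel p n (e p (i + 1) hj * X R i hi * e p (i + 1) hj)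
        (((p.lam⁻¹ : Rˣ) : R) • e p (i + 1) hj)
  | e_Xinv_e (i : ℕ) (hi : 1 ≤ i ∧ i < n) (hj : 1 ≤ i + 1 ∧ i + 1 < n) :
      BBRel p n (e p (i + 1) hj * Xinv R i hi * e p (i + 1) hj) ((p.lam : R) • e p (i + 1) hj)
  | XYXY (h : 1 ≤ n) (h1 : 1 ≤ 1 ∧ 1 < n) :
      BBRel p n (X R 1 h1 * Y R h * X R 1 h1 * Y R h) (Y R h * X R 1 h1 * Y R h * X R 1 h1)
  | Y_sq (h : 1 ≤ n) :
      BBRel p n (Y R h * Y R h) (p.q1 • Y R h + (p.q0 : R) • 1)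
  | YXYe (h : 1 ≤ n) (h1 : 1 ≤ 1 ∧ 1 < n) :
      BBRel p n (Y R h * X R 1 h1 * Y R h * e p 1 h1) (e p 1 h1)
  | Y_comm (i : ℕ) (h : 1 ≤ n) (hi : 1 ≤ i ∧ i < n) (h1 : 1 < i) :
      BBRel p n (Y R h * X R i hi) (X R i hi * Y R h)
  | eYe (h : 1 ≤ n) (h1 : 1 ≤ 1 ∧ 1 < n) :
      BBRel p n (e p 1 h1 * Y R h * e p 1 h1) (p.A • e p 1 h1)

/-- The reduced Birman-Murakami-Wenzl algebra `BB_n` of Coxeter type B. -/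
def BB {R : Type u} [CommRing R] (p : BBParams R) (n : ℕ) : Type u :=
  RingQuot (BBRel p n)

namespace BB

variable {R : Type u} [CommRing R] (p : BBParams R) (n : ℕ)

instance : Ring (BB p n) := inferInstanceAs (Ring (RingQuot (BBRel p n)))

instance : Algebra R (BB p n) := inferInstanceAs (Algebra R (RingQuot (BBRel p n)))

/-- The quotient map from the free algebra. -/
def mk : FreeAlgebra R (BBGen n) →ₐ[R] BB p n := RingQuot.mkAlgHom R (BBRel p n)

theorem mk_rel {a b : FreeAlgebra R (BBGen n)} (h : BBRel p n a b) : mk p n a = mk p n b :=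
  RingQuot.mkAlgHom_rel R h

/-- The universal property of `BB_n`. -/
def lift {B : Type*} [Ring B] [Algebra R B] (f : FreeAlgebra R (BBGen n) →ₐ[R] B)
    (hf : ∀ ⦃a b⦄, BBRel p n a b → f a = f b) : BB p n →ₐ[R] B :=
  RingQuot.liftAlgHom R ⟨f, hf⟩

theorem lift_mk {B : Type*} [Ring B] [Algebra R B] (f : FreeAlgebra R (BBGen n) →ₐ[R] B)
    (hf : ∀ ⦃a b⦄, BBRel p n a b → f a = f b) (a : FreeAlgebra R (BBGen n)) :
    lift p n f hf (mk p n a) = f a :=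
  RingQuot.liftAlgHom_mkAlgHom_apply R f hf a

/-- The element `e_i` of `BB_n`, for `1 ≤ i ≤ n - 1`. -/
def e {n : ℕ} (i : ℕ) (h : 1 ≤ i ∧ i < n) : BB p n := mk p n (BBFree.e p i h)

/-- A letter for `n` strands, read as a letter for `n + 1` strands. -/
def succGen {n : ℕ} : BBGen n → BBGen (n + 1)
  | .Y h => .Y (h.trans n.le_succ)
  | .Yinv h => .Yinv (h.trans n.le_succ)
  | .X i h => .X i ⟨h.1, h.2.trans n.lt_succ_self⟩
  | .Xinv i h => .Xinv i ⟨h.1, h.2.trans n.lt_succ_self⟩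

/-- The map of free algebras that sends every letter to the letter of the same name. -/
def freeIncl (R : Type u) [CommRing R] (n : ℕ) :
    FreeAlgebra R (BBGen n) →ₐ[R] FreeAlgebra R (BBGen (n + 1)) :=
  FreeAlgebra.lift R (fun g => FreeAlgebra.ι R (succGen g))

theorem freeIncl_rel {a b : FreeAlgebra R (BBGen n)} (h : BBRel p n a b) :
    BBRel p (n + 1) (freeIncl R n a) (freeIncl R n b) := by
  have hY : ∀ h, freeIncl R n (BBFree.Y R h) = BBFree.Y R (h.trans n.le_succ) := fun h => by
    simp [freeIncl, BBFree.Y, succGen]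
  have hYi : ∀ h, freeIncl R n (BBFree.Yinv R h) = BBFree.Yinv R (h.trans n.le_succ) :=
    fun h => by simp [freeIncl, BBFree.Yinv, succGen]
  have hX : ∀ i h, freeIncl R n (BBFree.X R i h) =
      BBFree.X R i ⟨h.1, h.2.trans n.lt_succ_self⟩ := fun i h => by
    simp [freeIncl, BBFree.X, succGen]
  have hXi : ∀ i h, freeIncl R n (BBFree.Xinv R i h) =
      BBFree.Xinv R i ⟨h.1, h.2.trans n.lt_succ_self⟩ := fun i h => by
    simp [freeIncl, BBFree.Xinv, succGen]
  have he : ∀ i h, freeIncl R n (BBFree.e p i h) =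
      BBFree.e p i ⟨h.1, h.2.trans n.lt_succ_self⟩ := fun i h => by
    simp [BBFree.e, hX, hXi]
  cases h <;> simp only [map_mul, map_add, map_smul, map_one, hY, hYi, hX, hXi, he]
  case Y_mul_Yinv h => exact .Y_mul_Yinv _
  case Yinv_mul_Y h => exact .Yinv_mul_Y _
  case X_mul_Xinv => exact .X_mul_Xinv _ _
  case Xinv_mul_X => exact .Xinv_mul_X _ _
  case X_comm hij => exact .X_comm _ _ _ _ hij
  case X_braid => exact .X_braid _ _ _
  case X_mul_e => exact .X_mul_e _ _
  case e_mul_X => exact .e_mul_X _ _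
  case e_X_e => exact .e_X_e _ _ _
  case e_Xinv_e => exact .e_Xinv_e _ _ _
  case XYXY => exact .XYXY _ _
  case Y_sq => exact .Y_sq _
  case YXYe => exact .YXYe _ _
  case Y_comm h1 => exact .Y_comm _ _ _ h1
  case eYe => exact .eYe _ _

/-- The canonical homomorphism `BB_n → BB_{n+1}`, generator to generator. -/
def incl : BB p n →ₐ[R] BB p (n + 1) :=
  lift p n ((mk p (n + 1)).comp (freeIncl R n))
    (fun _ _ h => mk_rel p (n + 1) (freeIncl_rel p n h))

/-- The element `e_{n+1}` of `BB_{n+2}`. -/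
def eTop : BB p (n + 2) := e p (n + 1) ⟨Nat.le_add_left 1 n, Nat.lt_succ_self _⟩

/-- The map `BB_n → BB_{n+2}`, `a ↦ x⁻¹ a e_{n+1}`. -/
def wenzlMap (a : BB p n) : BB p (n + 2) :=
  ((p.x⁻¹ : Rˣ) : R) • (incl p (n + 1) (incl p n a) * eTop p n)

/-- `b` satisfies the equation `e_{n+1} a e_{n+1} = x b e_{n+1}` that defines the conditional
expectation of `a`. -/
def IsCondExp (a : BB p (n + 1)) (b : BB p n) : Prop :=
  eTop p n * incl p (n + 1) a * eTop p n =
    (p.x : R) • (incl p (n + 1) (incl p n b) * eTop p n)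

open Classical in
/-- The conditional expectation `ε_n : BB_{n+1} → BB_n`, defined by
`e_{n+1} a e_{n+1} = x ε_n(a) e_{n+1}` (and by `0` if there were no such element). -/
def condExp (a : BB p (n + 1)) : BB p n :=
  if h : ∃ b, IsCondExp p n a b then h.choose else 0

/-- `BB_0`, which has no generators, is the ground ring: the algebra homomorphism to `R`. -/
def toGround : BB p 0 →ₐ[R] R :=
  lift p 0 (FreeAlgebra.lift R (fun g => by
    cases g <;> omega))
    (fun _ _ h => by cases h <;> omega)

/-- The trace `tr(a) = tr(ε_{n-1}(a))`, which is the identity of the ground ring on `BB_0`. -/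
def tr : (n : ℕ) → BB p n → R
  | 0 => fun a => toGround p a
  | n + 1 => fun a => tr n (condExp p n a)

/-- `f` is a trace: a linear functional with `f (a b) = f (b a)`. -/
def IsTrace {R : Type*} [CommRing R] {B : Type*} [Ring B] [Algebra R B] (f : B → R) : Prop :=
  IsLinearMap R f ∧ ∀ a b : B, f (a * b) = f (b * a)

/-- The two-sided ideal `I_{n+1}` of `BB_{n+1}` generated by `e_n`, for `n ≥ 1`. -/
def idealI (hn : 1 ≤ n) : TwoSidedIdeal (BB p (n + 1)) :=
  TwoSidedIdeal.span {e p n ⟨hn, Nat.lt_succ_self n⟩}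

end BB

/-- A ring that is not assumed to be unital (such as a two-sided ideal) is semisimple if it is
isomorphic to a semisimple ring. -/
def IsSemisimpleNonUnital (I : Type u) [NonUnitalRing I] : Prop :=
  ∃ (S : Type u) (_ : Ring S), IsSemisimpleRing S ∧ Nonempty (I ≃+* S)

end

/-! The engine is that `BB_{m+1}` is generated as a bimodule over `BB_m` by four elements: `1`,
`X_m`, `e_m` and the Jucys-Murphy element `Z_m = X_m ⋯ X_1 Y X_1 ⋯ X_m` (for `m = 0` by `1` and
`Y`), where `Z_m` commutes with `BB_m`. Since `e_{m+1}` commutes with `BB_m`, the equation defining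
`ε_m` is compatible with this bimodule structure. Existence of `ε_m` is therefore checked on four
elements (`exists_isCondExp`). Injectivity of `a ↦ x⁻¹ a e_{m+1}` gives uniqueness, so `ε_m` is a
linear bimodule map.

Now let `n = m + 1` and let `tr` be a trace on `BB_{m+1}`. The elements of `BB_{m+2}` that commute
with everything under `tr` form a subalgebra. It contains the image of `BB_{m+1}` because `ε_{m+1}`
is a bimodule map, so what is left is the generator `X = X_{m+1}`. For `a = u g v`, with `g` one of
the four generators, the claim becomes `tr(ε(X u g) v) = tr(u ε(g v X))`. The cases `g = 1` and `g =
Z` are direct. The cases `g = X` and `g = e` both come down to the map `ψ(b) = ε(X b e)` being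
self-adjoint for the form `tr(bc)` on `BB_{m+1}` (`tr_psi_mul`).

The map `ψ` is itself a `BB_m`-bimodule map, given on generators, up to the factor `x⁻¹`, by `1 ↦
λ`, `X ↦ e`, `e ↦ X⁻¹`, `Z ↦ Z⁻¹`. By cyclicity on `BB_{m+1}` and one more conditional expectation,
self-adjointness reduces to `ε(ψ(g) s g') = ε(g s ψ(g'))` for generators `g`, `g'` and `s` in
`BB_m`: a finite table (`condExp_psi_middle`). -/

noncomputable section

namespace BB

variable {R : Type u} [CommRing R] (p : BBParams R)

/-! ### Generators -/

/-- The generator `X_i` of `BB_k` (and `1` if there is no such generator). -/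
def X (k i : ℕ) : BB p k :=
  if h : 1 ≤ i ∧ i < k then mk p k (BBFree.X R i h) else 1

/-- The inverse of the generator `X_i` of `BB_k` (and `1` if there is no such generator). -/
def Xinv (k i : ℕ) : BB p k :=
  if h : 1 ≤ i ∧ i < k then mk p k (BBFree.Xinv R i h) else 1

/-- The generator `Y` of `BB_k` (and `1` if `k = 0`). -/
def Y (k : ℕ) : BB p k :=
  if h : 1 ≤ k then mk p k (BBFree.Y R h) else 1

/-- The inverse of the generator `Y` of `BB_k` (and `1` if `k = 0`). -/
def Yinv (k : ℕ) : BB p k :=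
  if h : 1 ≤ k then mk p k (BBFree.Yinv R h) else 1

/-- The element `e_i` of `BB_k`, for all indices. -/
def E (k i : ℕ) : BB p k := 1 - ((p.del⁻¹ : Rˣ) : R) • (X p k i - Xinv p k i)

/-- The Jucys-Murphy element `X_i ⋯ X_1 Y X_1 ⋯ X_i`. -/
def Z (k : ℕ) : ℕ → BB p k
  | 0 => Y p k
  | i + 1 => X p k (i + 1) * Z k i * X p k (i + 1)

/-- The inverse of the Jucys-Murphy element. -/
def Zinv (k : ℕ) : ℕ → BB p k
  | 0 => Yinv p k
  | i + 1 => Xinv p k (i + 1) * Zinv k i * Xinv p k (i + 1)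

variable {p} {k i j m : ℕ}

theorem mk_X (h : 1 ≤ i ∧ i < k) : mk p k (BBFree.X R i h) = X p k i := by
  rw [X, dif_pos h]

theorem mk_Xinv (h : 1 ≤ i ∧ i < k) : mk p k (BBFree.Xinv R i h) = Xinv p k i := by
  rw [Xinv, dif_pos h]

theorem mk_Y (h : 1 ≤ k) : mk p k (BBFree.Y R h) = Y p k := by rw [Y, dif_pos h]

theorem mk_Yinv (h : 1 ≤ k) : mk p k (BBFree.Yinv R h) = Yinv p k := by rw [Yinv, dif_pos h]

theorem mk_E (h : 1 ≤ i ∧ i < k) : mk p k (BBFree.e p i h) = E p k i := by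
  simp only [BBFree.e, map_sub, map_one, map_smul, mk_X, mk_Xinv, E]

theorem eTop_eq (n : ℕ) : eTop p n = E p (n + 2) (n + 1) := mk_E _

/-- Every subalgebra that contains the generators is everything. -/
theorem mem_of_generators (S : Subalgebra R (BB p k)) (hY : 1 ≤ k → Y p k ∈ S)
    (hYinv : 1 ≤ k → Yinv p k ∈ S) (hX : ∀ i, 1 ≤ i → i < k → X p k i ∈ S)
    (hXinv : ∀ i, 1 ≤ i → i < k → Xinv p k i ∈ S) (a : BB p k) : a ∈ S := by
  obtain ⟨a, rfl⟩ := RingQuot.mkAlgHom_surjective R (BBRel p k) a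
  change mk p k a ∈ S
  induction a using FreeAlgebra.induction with
  | grade0 r => rw [AlgHom.commutes]; exact S.algebraMap_mem r
  | grade1 g =>
    cases g with
    | Y h => exact mk_Y (p := p) h ▸ hY h
    | Yinv h => exact mk_Yinv (p := p) h ▸ hYinv h
    | X i h => exact mk_X (p := p) h ▸ hX i h.1 h.2
    | Xinv i h => exact mk_Xinv (p := p) h ▸ hXinv i h.1 h.2
  | mul a b ha hb => rw [map_mul]; exact S.mul_mem ha hb
  | add a b ha hb => rw [map_add]; exact S.add_mem ha hb

theorem incl_mk (a : FreeAlgebra R (BBGen k)) :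
    incl p k (mk p k a) = mk p (k + 1) (freeIncl R k a) := lift_mk _ _ _ _ _

theorem incl_X (hi : 1 ≤ i) (hk : i < k) : incl p k (X p k i) = X p (k + 1) i := by
  rw [← mk_X ⟨hi, hk⟩, ← mk_X ⟨hi, hk.trans k.lt_succ_self⟩, incl_mk]
  simp [freeIncl, BBFree.X, succGen]

theorem incl_Xinv (hi : 1 ≤ i) (hk : i < k) : incl p k (Xinv p k i) = Xinv p (k + 1) i := by
  rw [← mk_Xinv ⟨hi, hk⟩, ← mk_Xinv ⟨hi, hk.trans k.lt_succ_self⟩, incl_mk]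
  simp [freeIncl, BBFree.Xinv, succGen]

theorem incl_Y (hk : 1 ≤ k) : incl p k (Y p k) = Y p (k + 1) := by
  rw [← mk_Y hk, ← mk_Y (hk.trans k.le_succ), incl_mk]
  simp [freeIncl, BBFree.Y, succGen]

theorem incl_Yinv (hk : 1 ≤ k) : incl p k (Yinv p k) = Yinv p (k + 1) := by
  rw [← mk_Yinv hk, ← mk_Yinv (hk.trans k.le_succ), incl_mk]
  simp [freeIncl, BBFree.Yinv, succGen]

theorem incl_E (hi : 1 ≤ i) (hk : i < k) : incl p k (E p k i) = E p (k + 1) i := by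
  simp only [E, map_sub, map_one, map_smul, incl_X hi hk, incl_Xinv hi hk]

theorem incl_Z (hk : i < k) : incl p k (Z p k i) = Z p (k + 1) i := by
  induction i with
  | zero => exact incl_Y hk
  | succ i ih => rw [Z, Z, map_mul, map_mul, incl_X (by omega) hk, ih (by omega)]

theorem incl_Zinv (hk : i < k) : incl p k (Zinv p k i) = Zinv p (k + 1) i := by
  induction i with
  | zero => exact incl_Yinv hk
  | succ i ih => rw [Zinv, Zinv, map_mul, map_mul, incl_Xinv (by omega) hk, ih (by omega)]

/-! ### Relations in one or two strands -/

theorem X_mul_Xinv : X p k i * Xinv p k i = 1 := by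
  by_cases h : 1 ≤ i ∧ i < k
  · rw [← mk_X h, ← mk_Xinv h, ← map_mul, mk_rel p k (.X_mul_Xinv i h), map_one]
  · simp [X, Xinv, h]

theorem Xinv_mul_X : Xinv p k i * X p k i = 1 := by
  by_cases h : 1 ≤ i ∧ i < k
  · rw [← mk_X h, ← mk_Xinv h, ← map_mul, mk_rel p k (.Xinv_mul_X i h), map_one]
  · simp [X, Xinv, h]

theorem Y_mul_Yinv : Y p k * Yinv p k = 1 := by
  by_cases h : 1 ≤ k
  · rw [← mk_Y h, ← mk_Yinv h, ← map_mul, mk_rel p k (.Y_mul_Yinv h), map_one]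
  · simp [Y, Yinv, h]

theorem Yinv_mul_Y : Yinv p k * Y p k = 1 := by
  by_cases h : 1 ≤ k
  · rw [← mk_Y h, ← mk_Yinv h, ← map_mul, mk_rel p k (.Yinv_mul_Y h), map_one]
  · simp [Y, Yinv, h]

theorem X_mul_Xinv_cancel (a : BB p k) : X p k i * (Xinv p k i * a) = a := by
  rw [← mul_assoc, X_mul_Xinv, one_mul]

theorem Xinv_mul_X_cancel (a : BB p k) : Xinv p k i * (X p k i * a) = a := by
  rw [← mul_assoc, Xinv_mul_X, one_mul]

theorem Z_mul_Zinv : Z p k i * Zinv p k i = 1 := by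
  induction i with
  | zero => exact Y_mul_Yinv
  | succ i ih =>
    simp only [Z, Zinv, mul_assoc, X_mul_Xinv_cancel]
    rw [← mul_assoc (Z p k i), ih, one_mul, X_mul_Xinv]

theorem Zinv_mul_Z : Zinv p k i * Z p k i = 1 := by
  induction i with
  | zero => exact Yinv_mul_Y
  | succ i ih =>
    simp only [Z, Zinv, mul_assoc, Xinv_mul_X_cancel]
    rw [← mul_assoc (Zinv p k i), ih, one_mul, Xinv_mul_X]

theorem Z_mul_Zinv_cancel (a : BB p k) : Z p k i * (Zinv p k i * a) = a := by
  rw [← mul_assoc, Z_mul_Zinv, one_mul]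

theorem Zinv_mul_Z_cancel (a : BB p k) : Zinv p k i * (Z p k i * a) = a := by
  rw [← mul_assoc, Zinv_mul_Z, one_mul]

theorem X_mul_E (hi : 1 ≤ i) (hk : i < k) : X p k i * E p k i = (p.lam : R) • E p k i := by
  rw [← mk_X ⟨hi, hk⟩, ← mk_E ⟨hi, hk⟩, ← map_mul, mk_rel p k (.X_mul_e i _), map_smul]

theorem E_mul_X (hi : 1 ≤ i) (hk : i < k) : E p k i * X p k i = (p.lam : R) • E p k i := by
  rw [← mk_X ⟨hi, hk⟩, ← mk_E ⟨hi, hk⟩, ← map_mul, mk_rel p k (.e_mul_X i _), map_smul]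

theorem Xinv_mul_E (hi : 1 ≤ i) (hk : i < k) :
    Xinv p k i * E p k i = ((p.lam⁻¹ : Rˣ) : R) • E p k i := by
  have h := congrArg (fun a => ((p.lam⁻¹ : Rˣ) : R) • (Xinv p k i * a)) (X_mul_E (p := p) hi hk)
  simpa [Xinv_mul_X_cancel, smul_smul] using h.symm

theorem E_mul_Xinv (hi : 1 ≤ i) (hk : i < k) :
    E p k i * Xinv p k i = ((p.lam⁻¹ : Rˣ) : R) • E p k i := by
  have h := congrArg (fun a => ((p.lam⁻¹ : Rˣ) : R) • (a * Xinv p k i)) (E_mul_X (p := p) hi hk)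
  simpa [mul_assoc, X_mul_Xinv, smul_smul] using h.symm

theorem Xinv_eq (k i : ℕ) :
    Xinv p k i = X p k i - (p.del : R) • 1 + (p.del : R) • E p k i := by
  simp [E, smul_sub, smul_smul]

theorem X_eq (k i : ℕ) :
    X p k i = Xinv p k i + (p.del : R) • 1 - (p.del : R) • E p k i := by
  rw [Xinv_eq]; module

theorem X_mul_X (hi : 1 ≤ i) (hk : i < k) : X p k i * X p k i =
    1 + (p.del : R) • X p k i - ((p.del : R) * p.lam) • E p k i := by
  nth_rewrite 2 [X_eq]
  rw [mul_sub, mul_add, X_mul_Xinv, mul_smul_comm, mul_smul_comm, mul_one, X_mul_E hi hk,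
    smul_smul]

theorem E_mul_E (hi : 1 ≤ i) (hk : i < k) : E p k i * E p k i = (p.x : R) • E p k i := by
  nth_rewrite 2 [E]
  rw [mul_sub, mul_smul_comm, mul_sub, E_mul_X hi hk, E_mul_Xinv hi hk, mul_one, ← sub_smul,
    smul_smul]
  nth_rewrite 1 [← one_smul R (E p k i)]
  rw [← sub_smul]
  congr 1
  have h := p.x_mul_del
  -- The scalar identity is the defining relation of `x` divided by `δ`.
  have h1 := p.del.mul_inv
  linear_combination (-(p.del⁻¹ : Rˣ) : R) * h + (p.x - 1 : R) * h1

theorem braid (hi : 1 ≤ i) (hk : i + 1 < k) :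
    X p k i * (X p k (i + 1) * X p k i) = X p k (i + 1) * (X p k i * X p k (i + 1)) := by
  rw [← mul_assoc, ← mul_assoc, ← mk_X ⟨hi, by omega⟩, ← mk_X ⟨by omega, hk⟩, ← map_mul,
    ← map_mul, mk_rel p k (.X_braid i _ _)]
  simp only [map_mul]

theorem E_X_E (hi : 1 ≤ i) (hk : i + 1 < k) :
    E p k (i + 1) * (X p k i * E p k (i + 1)) = ((p.lam⁻¹ : Rˣ) : R) • E p k (i + 1) := by
  rw [← mul_assoc, ← mk_X ⟨hi, by omega⟩, ← mk_E ⟨by omega, hk⟩, ← map_mul,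
    ← map_mul, mk_rel p k (.e_X_e i _ _), map_smul]

theorem E_Xinv_E (hi : 1 ≤ i) (hk : i + 1 < k) :
    E p k (i + 1) * (Xinv p k i * E p k (i + 1)) = (p.lam : R) • E p k (i + 1) := by
  rw [← mul_assoc, ← mk_Xinv ⟨hi, by omega⟩, ← mk_E ⟨by omega, hk⟩, ← map_mul,
    ← map_mul, mk_rel p k (.e_Xinv_e i _ _), map_smul]

theorem E_E_E (hi : 1 ≤ i) (hk : i + 1 < k) :
    E p k (i + 1) * (E p k i * E p k (i + 1)) = E p k (i + 1) := by
  nth_rewrite 2 [E]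
  rw [sub_mul, smul_mul_assoc, sub_mul, one_mul, mul_sub, mul_smul_comm, mul_sub, E_X_E hi hk,
    E_Xinv_E hi hk, E_mul_E (by omega) hk]
  nth_rewrite 4 [← one_smul R (E p k (i + 1))]
  rw [← sub_smul, smul_smul, ← sub_smul]
  congr 1
  have h := p.x_mul_del
  have h1 := p.del.mul_inv
  linear_combination ((p.del⁻¹ : Rˣ) : R) * h + (1 - p.x : R) * h1

/-! ### Intertwining and untwisting relations -/

/-- An element that intertwines `X_i` and `X_j` also intertwines `e_i` and `e_j`. -/
theorem E_conj {c : BB p k} (h : c * X p k i = X p k j * c) : c * E p k i = E p k j * c := by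
  have h' : c * Xinv p k i = Xinv p k j * c := by
    have h1 := congrArg (fun a => Xinv p k j * (a * Xinv p k i)) h
    simpa [mul_assoc, Xinv_mul_X_cancel, X_mul_Xinv] using h1.symm
  rw [E, E, mul_sub, sub_mul, mul_smul_comm, smul_mul_assoc, mul_sub, sub_mul, h, h', one_mul,
    mul_one]

theorem Xinv_comm_of_comm {c : BB p k} (h : Commute c (X p k i)) : Commute c (Xinv p k i) := by
  change c * Xinv p k i = Xinv p k i * c
  have h1 := congrArg (fun a => Xinv p k i * (a * Xinv p k i)) h.eq
  simpa [mul_assoc, Xinv_mul_X_cancel, X_mul_Xinv] using h1.symm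

theorem E_comm_of_comm {c : BB p k} (h : Commute c (X p k i)) : Commute c (E p k i) := E_conj h

/-- By the braid relation `X_i X_{i+1}` intertwines `X_i` with `X_{i+1}`, hence also `e_i` with
`e_{i+1}`. -/
theorem X_X_E (hi : 1 ≤ i) (hk : i + 1 < k) :
    X p k i * (X p k (i + 1) * E p k i) = E p k (i + 1) * (X p k i * X p k (i + 1)) := by
  rw [← mul_assoc]
  exact E_conj (by rw [mul_assoc, braid hi hk])

theorem X_X_E' (hi : 1 ≤ i) (hk : i + 1 < k) :
    X p k (i + 1) * (X p k i * E p k (i + 1)) = E p k i * (X p k (i + 1) * X p k i) := by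
  rw [← mul_assoc]
  exact E_conj (by rw [mul_assoc, braid hi hk])

theorem Xinv_Xinv_E (hi : 1 ≤ i) (hk : i + 1 < k) :
    Xinv p k i * (Xinv p k (i + 1) * E p k i) =
      E p k (i + 1) * (Xinv p k i * Xinv p k (i + 1)) := by
  have h := congrArg (fun a => Xinv p k i * (Xinv p k (i + 1) *
    (a * (Xinv p k i * Xinv p k (i + 1))))) (X_X_E' (p := p) hi hk)
  simp only [mul_assoc, Xinv_mul_X_cancel, X_mul_Xinv_cancel, X_mul_Xinv, mul_one] at h
  exact h.symm

theorem Xinv_Xinv_E' (hi : 1 ≤ i) (hk : i + 1 < k) :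
    Xinv p k (i + 1) * (Xinv p k i * E p k (i + 1)) =
      E p k i * (Xinv p k (i + 1) * Xinv p k i) := by
  have h := congrArg (fun a => Xinv p k (i + 1) * (Xinv p k i *
    (a * (Xinv p k (i + 1) * Xinv p k i)))) (X_X_E (p := p) hi hk)
  simp only [mul_assoc, Xinv_mul_X_cancel, X_mul_Xinv_cancel, X_mul_Xinv, mul_one] at h
  exact h.symm

/-- Moving `X_{i+1} X_i` through `e_i` produces `e_{i+1} X_{i+1} X_i e_{i+1}`, where the factors `λ`
and `λ⁻¹` cancel. This and the next three lemmas trade a factor `X_i^{±1}` beside an outer `e_{i+1}`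
for `X_{i+1}^{∓1}` beyond `e_i`, where it commutes with the smaller algebra. -/
theorem E_E_X (hi : 1 ≤ i) (hk : i + 1 < k) :
    E p k (i + 1) * (E p k i * X p k (i + 1)) = E p k (i + 1) * Xinv p k i := by
  have h : E p k (i + 1) * (E p k i * (X p k (i + 1) * X p k i)) = E p k (i + 1) := by
    rw [← X_X_E' hi hk, ← mul_assoc, E_mul_X (by omega) hk, smul_mul_assoc, E_X_E hi hk,
      smul_smul, Units.mul_inv, one_smul]
  have h1 := congrArg (· * Xinv p k i) h
  simpa only [mul_assoc, X_mul_Xinv, mul_one] using h1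

theorem E_E_Xinv (hi : 1 ≤ i) (hk : i + 1 < k) :
    E p k (i + 1) * (E p k i * Xinv p k (i + 1)) = E p k (i + 1) * X p k i := by
  have h : E p k (i + 1) * (E p k i * (Xinv p k (i + 1) * Xinv p k i)) = E p k (i + 1) := by
    rw [← Xinv_Xinv_E' hi hk, ← mul_assoc, E_mul_Xinv (by omega) hk, smul_mul_assoc,
      E_Xinv_E hi hk, smul_smul, Units.inv_mul, one_smul]
  have h1 := congrArg (· * X p k i) h
  simpa only [mul_assoc, Xinv_mul_X, mul_one] using h1

theorem X_E_E (hi : 1 ≤ i) (hk : i + 1 < k) :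
    X p k (i + 1) * (E p k i * E p k (i + 1)) = Xinv p k i * E p k (i + 1) := by
  have h : X p k i * (X p k (i + 1) * (E p k i * E p k (i + 1))) = E p k (i + 1) := by
    have := congrArg (· * E p k (i + 1)) (X_X_E (p := p) hi hk)
    simp only [mul_assoc, X_mul_E (p := p) (show 1 ≤ i + 1 by omega) hk, mul_smul_comm,
      E_X_E hi hk, smul_smul, Units.mul_inv, one_smul] at this
    exact this
  have h1 := congrArg (Xinv p k i * ·) h
  simpa only [Xinv_mul_X_cancel] using h1

theorem Xinv_E_E (hi : 1 ≤ i) (hk : i + 1 < k) :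
    Xinv p k (i + 1) * (E p k i * E p k (i + 1)) = X p k i * E p k (i + 1) := by
  have h : Xinv p k i * (Xinv p k (i + 1) * (E p k i * E p k (i + 1))) = E p k (i + 1) := by
    have := congrArg (· * E p k (i + 1)) (Xinv_Xinv_E (p := p) hi hk)
    simp only [mul_assoc, Xinv_mul_E (p := p) (show 1 ≤ i + 1 by omega) hk, mul_smul_comm,
      E_Xinv_E hi hk, smul_smul, Units.inv_mul, one_smul] at this
    exact this
  have h1 := congrArg (X p k i * ·) h
  simpa only [X_mul_Xinv_cancel] using h1

theorem E_X_X (hi : 1 ≤ i) (hk : i + 1 < k) :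
    E p k (i + 1) * (X p k i * X p k (i + 1)) = E p k (i + 1) * E p k i := by
  have h := congrArg (· * X p k (i + 1)) (E_E_Xinv (p := p) hi hk)
  simpa only [mul_assoc, Xinv_mul_X, mul_one] using h.symm

theorem X_E_X (hi : 1 ≤ i) (hk : i + 1 < k) :
    X p k (i + 1) * (E p k i * X p k (i + 1)) =
      Xinv p k i * (E p k (i + 1) * Xinv p k i) := by
  have h : X p k (i + 1) * E p k i = Xinv p k i * (E p k (i + 1) * E p k i) := by
    rw [← E_X_X hi hk, ← X_X_E hi hk, Xinv_mul_X_cancel]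
  rw [← mul_assoc, h, mul_assoc, mul_assoc, E_E_X hi hk]


/-! ### Far commutativity and Jucys-Murphy elements -/

theorem X_comm (hi : 1 ≤ i) (hij : i + 1 < j) (hk : j < k) : Commute (X p k i) (X p k j) := by
  change X p k i * X p k j = X p k j * X p k i
  rw [← mk_X ⟨hi, by omega⟩, ← mk_X ⟨by omega, hk⟩, ← map_mul, ← map_mul,
    mk_rel p k (.X_comm i j _ _ hij)]

theorem Y_comm_X (hi : 1 < i) (hk : i < k) : Commute (Y p k) (X p k i) := by
  change Y p k * X p k i = X p k i * Y p k
  rw [← mk_Y (by omega), ← mk_X ⟨by omega, hk⟩, ← map_mul, ← map_mul,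
    mk_rel p k (.Y_comm i _ _ hi)]

theorem Commute.Yinv_left_of {c : BB p k} (h : Commute (Y p k) c) : Commute (Yinv p k) c := by
  change Yinv p k * c = c * Yinv p k
  have h1 := congrArg (fun a => Yinv p k * (a * Yinv p k)) h.eq
  simp only [mul_assoc, Y_mul_Yinv, mul_one] at h1
  rw [← mul_assoc (Yinv p k) (Y p k), Yinv_mul_Y, one_mul] at h1
  exact h1.symm

theorem Commute.Zinv_right_of {c : BB p k} (h : Commute c (Z p k i)) :
    Commute c (Zinv p k i) := by
  change c * Zinv p k i = Zinv p k i * c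
  have h1 := congrArg (fun a => Zinv p k i * (a * Zinv p k i)) h.eq
  simpa [mul_assoc, Zinv_mul_Z_cancel, Z_mul_Zinv] using h1.symm

theorem Y_mul_Y (hk : 1 ≤ k) : Y p k * Y p k = p.q1 • Y p k + (p.q0 : R) • 1 := by
  rw [← mk_Y hk, ← map_mul, mk_rel p k (.Y_sq hk), map_add, map_smul, map_smul, map_one]

theorem Z_comm_X_of_gt (hij : i + 1 < j) (hk : j < k) : Commute (Z p k i) (X p k j) := by
  induction i with
  | zero => exact Y_comm_X (by omega) hk
  | succ i ih =>
    have h : Commute (X p k (i + 1)) (X p k j) := X_comm (by omega) (by omega) hk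
    exact (h.mul_left (ih (by omega))).mul_left h

theorem Z_comm_X_of_lt (hj : 1 ≤ j) (hij : j < i) (hk : i < k) :
    Commute (Z p k i) (X p k j) := by
  induction i with
  | zero => omega
  | succ i ih =>
    rcases Nat.lt_succ_iff_lt_or_eq.mp hij with h | rfl
    · have hc : Commute (X p k (i + 1)) (X p k j) := (X_comm hj (by omega) hk).symm
      exact (hc.mul_left (ih h (by omega))).mul_left hc
    · obtain ⟨m, rfl⟩ : ∃ m, j = m + 1 := ⟨j - 1, by omega⟩
      -- In `X_{m+2} X_{m+1} Z_m X_{m+1} X_{m+2}`, the factor `X_{m+1}` passes from right to left by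
      -- a braid move on each side of `Z_m`; in between, `X_{m+2}` crosses `Z_m`.
      have hb := braid (p := p) hj hk
      have hc := (Z_comm_X_of_gt (p := p) (i := m) (j := m + 2) (by omega) hk).eq
      change Z p k (m + 2) * X p k (m + 1) = X p k (m + 1) * Z p k (m + 2)
      simp only [Z, mul_assoc]
      rw [hb, ← mul_assoc (Z p k m), hc, ← mul_assoc (X p k (m + 1)) (X p k (m + 2)),
        ← mul_assoc (X p k (m + 1) * X p k (m + 2)), mul_assoc (X p k (m + 1)), hb]
      simp only [mul_assoc]

theorem Z_comm_Y (hi : 1 ≤ i) (hk : i < k) : Commute (Z p k i) (Y p k) := by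
  induction i, hi using Nat.le_induction with
  | base =>
    change X p k 1 * Y p k * X p k 1 * Y p k = Y p k * (X p k 1 * Y p k * X p k 1)
    have h := mk_rel p k (.XYXY (by omega) ⟨le_rfl, hk⟩)
    simp only [map_mul, mk_X, mk_Y] at h
    rw [h]
    simp only [mul_assoc]
  | succ i hi ih =>
    have h : Commute (X p k (i + 1)) (Y p k) := (Y_comm_X (by omega) hk).symm
    exact (h.mul_left (ih (by omega))).mul_left h

theorem Z_comm_Z (hij : j < i) (hk : i < k) : Commute (Z p k i) (Z p k j) := by
  induction j with
  | zero => exact Z_comm_Y (by omega) hk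
  | succ j ih =>
    have h : Commute (Z p k i) (X p k (j + 1)) := Z_comm_X_of_lt (by omega) hij hk
    exact (h.mul_right (ih (by omega))).mul_right h

/-- The relation `Y X_1 Y e_1 = e_1` propagates to all strands. For the first strand, `Y X_1 Y`
commutes with `X_1`, so `e_1` may stand on either side. The induction step expands the outer
Jucys-Murphy elements and uses a braid move to expose the previous case. -/
theorem E_Z_X_Z (hk : i + 1 < k) :
    E p k (i + 1) * (Z p k i * (X p k (i + 1) * Z p k i)) = E p k (i + 1) := by
  induction i with
  | zero =>
    have h := mk_rel p k (.YXYe (by omega) ⟨le_rfl, hk⟩)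
    simp only [map_mul, mk_X, mk_Y, mk_E] at h
    have hc : Commute (Y p k * X p k 1 * Y p k) (X p k 1) := by
      have := (Z_comm_Y (p := p) le_rfl hk).eq
      simp only [Z, zero_add, mul_assoc] at this
      change _ * _ = _ * _
      simp only [mul_assoc]
      exact this.symm
    have := (E_comm_of_comm hc).eq
    simp only [Z, zero_add, mul_assoc] at this h ⊢
    rw [← this, h]
  | succ m ih =>
    have hb := braid (p := p) (i := m + 1) (by omega) hk
    have hc := (Z_comm_X_of_gt (p := p) (i := m) (j := m + 2) (by omega) hk).eq
    have hx : E p k (m + 2) * (E p k (m + 1) * (X p k (m + 2) * X p k (m + 1))) =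
        E p k (m + 2) := by
      rw [← mul_assoc (E p k (m + 1)), ← mul_assoc, E_E_X (by omega) hk, mul_assoc,
        Xinv_mul_X, mul_one]
    calc E p k (m + 2) * (Z p k (m + 1) * (X p k (m + 2) * Z p k (m + 1)))
        = E p k (m + 2) * (X p k (m + 1) * (Z p k m * ((X p k (m + 1) * (X p k (m + 2) *
            X p k (m + 1))) * (Z p k m * X p k (m + 1))))) := by simp only [Z, mul_assoc]
      _ = E p k (m + 2) * (X p k (m + 1) * ((Z p k m * X p k (m + 2)) * (X p k (m + 1) *
            ((X p k (m + 2) * Z p k m) * X p k (m + 1))))) := by rw [hb]; simp only [mul_assoc]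
      _ = (E p k (m + 2) * (X p k (m + 1) * X p k (m + 2))) * (Z p k m * (X p k (m + 1) *
            (Z p k m * (X p k (m + 2) * X p k (m + 1))))) := by
          rw [← hc]; nth_rewrite 1 [hc]; simp only [mul_assoc]
      _ = E p k (m + 2) * ((E p k (m + 1) * (Z p k m * (X p k (m + 1) * Z p k m))) *
            (X p k (m + 2) * X p k (m + 1))) := by
          rw [E_X_X (by omega) hk]; simp only [mul_assoc]
      _ = E p k (m + 2) := by rw [ih (by omega), hx]

theorem Z_X_Z_comm_E (hk : i + 1 < k) :
    Commute (Z p k i * (X p k (i + 1) * Z p k i)) (E p k (i + 1)) := by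
  refine E_comm_of_comm ?_
  have := (Z_comm_Z (p := p) i.lt_succ_self hk).eq
  simp only [Z, mul_assoc] at this
  change _ * _ = _ * _
  simp only [mul_assoc]
  exact this.symm

theorem E_Z_X (hk : i + 1 < k) :
    E p k (i + 1) * (Z p k i * X p k (i + 1)) = E p k (i + 1) * Zinv p k i := by
  have h := congrArg (· * Zinv p k i) (E_Z_X_Z (p := p) hk)
  simpa only [mul_assoc, Z_mul_Zinv, mul_one] using h

theorem X_Z_E (hk : i + 1 < k) :
    X p k (i + 1) * (Z p k i * E p k (i + 1)) = Zinv p k i * E p k (i + 1) := by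
  have h := congrArg (Zinv p k i * ·) ((Z_X_Z_comm_E (p := p) hk).eq.trans (E_Z_X_Z hk))
  simpa only [mul_assoc, Zinv_mul_Z_cancel] using h

theorem E_Zinv_Xinv (hk : i + 1 < k) :
    E p k (i + 1) * (Zinv p k i * Xinv p k (i + 1)) = E p k (i + 1) * Z p k i := by
  have h := congrArg (· * Xinv p k (i + 1)) (E_Z_X (p := p) hk)
  simpa only [mul_assoc, X_mul_Xinv, mul_one] using h.symm

/-! ### Commutation with smaller algebras -/

theorem incl_comm_Z (n : ℕ) (a : BB p n) : Commute (incl p n a) (Z p (n + 1) n) := by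
  let S : Subalgebra R (BB p n) :=
    (Subalgebra.centralizer R {Z p (n + 1) n}).comap (incl p n)
  have hS : ∀ b, b ∈ S ↔ Commute (incl p n b) (Z p (n + 1) n) := fun b => by
    simp [S, Subalgebra.mem_centralizer_iff, Commute, SemiconjBy, eq_comm]
  refine (hS a).1 (mem_of_generators S (fun h => ?_) (fun h => ?_) (fun i h1 h2 => ?_)
    (fun i h1 h2 => ?_) a) <;> rw [hS]
  · rw [incl_Y h]; exact (Z_comm_Y h n.lt_succ_self).symm
  · rw [incl_Yinv h]; exact Commute.Yinv_left_of (Z_comm_Y h n.lt_succ_self).symm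
  · rw [incl_X h1 h2]; exact (Z_comm_X_of_lt h1 h2 n.lt_succ_self).symm
  · rw [incl_Xinv h1 h2]
    exact (Xinv_comm_of_comm (Z_comm_X_of_lt h1 h2 n.lt_succ_self)).symm

theorem incl_comm_Zinv (n : ℕ) (a : BB p n) : Commute (incl p n a) (Zinv p (n + 1) n) :=
  Commute.Zinv_right_of (incl_comm_Z n a)

theorem incl_incl_comm_X (n : ℕ) (a : BB p n) :
    Commute (incl p (n + 1) (incl p n a)) (X p (n + 2) (n + 1)) := by
  let S : Subalgebra R (BB p n) :=
    (Subalgebra.centralizer R {X p (n + 2) (n + 1)}).comap ((incl p (n + 1)).comp (incl p n))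
  have hS : ∀ b, b ∈ S ↔ Commute (incl p (n + 1) (incl p n b)) (X p (n + 2) (n + 1)) :=
    fun b => by simp [S, Subalgebra.mem_centralizer_iff, Commute, SemiconjBy, eq_comm]
  refine (hS a).1 (mem_of_generators S (fun h => ?_) (fun h => ?_) (fun i h1 h2 => ?_)
    (fun i h1 h2 => ?_) a) <;> rw [hS]
  · rw [incl_Y h, incl_Y (by omega)]; exact Y_comm_X (by omega) (by omega)
  · rw [incl_Yinv h, incl_Yinv (by omega)]
    exact Commute.Yinv_left_of (Y_comm_X (by omega) (by omega))
  · rw [incl_X h1 h2, incl_X h1 (by omega)]; exact X_comm h1 (by omega) (by omega)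
  · rw [incl_Xinv h1 h2, incl_Xinv h1 (by omega)]
    exact (Xinv_comm_of_comm (X_comm h1 (by omega) (by omega)).symm).symm

theorem incl_incl_comm_Xinv (n : ℕ) (a : BB p n) :
    Commute (incl p (n + 1) (incl p n a)) (Xinv p (n + 2) (n + 1)) :=
  Xinv_comm_of_comm (incl_incl_comm_X n a)

theorem incl_incl_comm_E (n : ℕ) (a : BB p n) :
    Commute (incl p (n + 1) (incl p n a)) (E p (n + 2) (n + 1)) :=
  E_comm_of_comm (incl_incl_comm_X n a)

/-! ### A spanning set for `BB_{n+1}` over `BB_n` -/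

variable (p) in
/-- The elements that generate `BB_{n+1}` as a bimodule over `BB_n`. -/
def middle (n : ℕ) : Set (BB p (n + 1)) :=
  -- The guard drops the default value of `X` at index 0, so that for `n = 0` only `1` and `Y` are
  -- listed.
  {g | g = 1 ∨ g = Z p (n + 1) n ∨ (1 ≤ n ∧ (g = X p (n + 1) n ∨ g = E p (n + 1) n))}

variable (p) in
/-- The bimodule over `BB_n` generated by `1`, `X_n`, `e_n` and the Jucys-Murphy element. -/
def middleSpan (n : ℕ) : Submodule R (BB p (n + 1)) :=
  Submodule.span R {a | ∃ g ∈ middle p n, ∃ b c, a = incl p n b * g * incl p n c}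

theorem mem_middleSpan {n : ℕ} {g : BB p (n + 1)} (hg : g ∈ middle p n) :
    g ∈ middleSpan p n :=
  Submodule.subset_span ⟨g, hg, 1, 1, by simp⟩

theorem mul_mem_middleSpan {n : ℕ} (b c : BB p n) {a : BB p (n + 1)}
    (ha : a ∈ middleSpan p n) : incl p n b * a * incl p n c ∈ middleSpan p n := by
  induction ha using Submodule.span_induction with
  | mem a ha =>
    obtain ⟨g, hg, u, v, rfl⟩ := ha
    exact Submodule.subset_span ⟨g, hg, b * u, v * c, by simp only [map_mul, mul_assoc]⟩
  | zero => simp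
  | add a a' _ _ h h' => rw [mul_add, add_mul]; exact add_mem h h'
  | smul r a _ h => rw [mul_smul_comm, smul_mul_assoc]; exact Submodule.smul_mem _ _ h

theorem incl_mul_mem_middleSpan {n : ℕ} (b : BB p n) {a : BB p (n + 1)}
    (ha : a ∈ middleSpan p n) : incl p n b * a ∈ middleSpan p n := by
  simpa using mul_mem_middleSpan b 1 ha

theorem mul_incl_mem_middleSpan {n : ℕ} (c : BB p n) {a : BB p (n + 1)}
    (ha : a ∈ middleSpan p n) : a * incl p n c ∈ middleSpan p n := by
  simpa using mul_mem_middleSpan 1 c ha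

theorem one_mem_middle (n : ℕ) : 1 ∈ middle p n := Or.inl rfl

theorem Z_mem_middle (n : ℕ) : Z p (n + 1) n ∈ middle p n := Or.inr (Or.inl rfl)

theorem X_mem_middle (n : ℕ) : X p (n + 2) (n + 1) ∈ middle p (n + 1) :=
  Or.inr (Or.inr ⟨by omega, Or.inl rfl⟩)

theorem E_mem_middle (n : ℕ) : E p (n + 2) (n + 1) ∈ middle p (n + 1) :=
  Or.inr (Or.inr ⟨by omega, Or.inr rfl⟩)

theorem middle_zero {g : BB p 1} (hg : g ∈ middle p 0) : g = 1 ∨ g = Y p 1 := by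
  rcases hg with h | h | ⟨h, -⟩
  · exact Or.inl h
  · exact Or.inr h
  · omega

theorem middle_succ {n : ℕ} {g : BB p (n + 2)} (hg : g ∈ middle p (n + 1)) :
    g = 1 ∨ g = Z p (n + 2) (n + 1) ∨ g = X p (n + 2) (n + 1) ∨ g = E p (n + 2) (n + 1) := by
  rcases hg with h | h | ⟨-, h⟩
  · exact Or.inl h
  · exact Or.inr (Or.inl h)
  · exact Or.inr (Or.inr h)

variable (p) in
/-- The elements that map the spanned bimodule to itself by multiplication on the right. -/
def rightStabilizer (n : ℕ) : Subalgebra R (BB p (n + 1)) where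
  carrier := {x | ∀ a ∈ middleSpan p n, a * x ∈ middleSpan p n}
  mul_mem' {x y} hx hy a ha := by rw [← mul_assoc]; exact hy _ (hx a ha)
  add_mem' {x y} hx hy a ha := by rw [mul_add]; exact add_mem (hx a ha) (hy a ha)
  algebraMap_mem' r a ha := by
    rw [← Algebra.commutes, ← Algebra.smul_def]; exact Submodule.smul_mem _ _ ha

theorem incl_mem_rightStabilizer {n : ℕ} (c : BB p n) :
    incl p n c ∈ rightStabilizer p n := fun _ ha => mul_incl_mem_middleSpan c ha

theorem mem_rightStabilizer {n : ℕ} {x : BB p (n + 1)}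
    (h : ∀ g ∈ middle p n, ∀ c, g * incl p n c * x ∈ middleSpan p n) :
    x ∈ rightStabilizer p n := fun a ha => by
  induction ha using Submodule.span_induction with
  | mem a ha =>
    obtain ⟨g, hg, u, v, rfl⟩ := ha
    have := incl_mul_mem_middleSpan u (h g hg v)
    simpa only [mul_assoc] using this
  | zero => simp
  | add a a' _ _ h h' => rw [add_mul]; exact add_mem h h'
  | smul r a _ h => rw [smul_mul_assoc]; exact Submodule.smul_mem _ _ h

theorem middleSpan_eq_top_of_rightStabilizer {n : ℕ} (h : ∀ a, a ∈ rightStabilizer p n) :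
    middleSpan p n = ⊤ :=
  eq_top_iff.mpr fun a _ => by
    simpa using h a 1 (mem_middleSpan (one_mem_middle n))

theorem middleSpan_zero : middleSpan p 0 = ⊤ := by
  have hY : Y p 1 ∈ rightStabilizer p 0 := mem_rightStabilizer fun g hg c => by
    have hc : Commute (incl p 0 c) (Y p 1) := incl_comm_Z 0 c
    rw [mul_assoc, hc.eq, ← mul_assoc]
    refine mul_incl_mem_middleSpan c ?_
    have h1 := mem_middleSpan (one_mem_middle (p := p) 0)
    have hZ : Y p 1 ∈ middleSpan p 0 := mem_middleSpan (Z_mem_middle 0)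
    rcases middle_zero hg with rfl | rfl
    · rwa [one_mul]
    · rw [Y_mul_Y le_rfl]
      exact add_mem (Submodule.smul_mem _ _ hZ) (Submodule.smul_mem _ _ h1)
  refine middleSpan_eq_top_of_rightStabilizer (mem_of_generators _ (fun _ => hY) (fun _ => ?_)
    (fun i h1 h2 => by omega) (fun i h1 h2 => by omega))
  -- Since `q0` is a unit, the quadratic relation expresses `Y⁻¹` through `Y` and `1`.
  have h : Yinv p 1 = ((p.q0⁻¹ : Rˣ) : R) • (Y p 1 - p.q1 • 1) := by
    have h := congrArg (fun a => ((p.q0⁻¹ : Rˣ) : R) • (Yinv p 1 * a)) (Y_mul_Y (p := p) le_rfl)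
    simp only [mul_add, mul_smul_comm, mul_one, Yinv_mul_Y, smul_add, smul_smul, Units.inv_mul,
      one_smul] at h
    rw [← mul_assoc, Yinv_mul_Y, one_mul] at h
    rw [smul_sub, h, smul_smul, add_sub_cancel_left]
  rw [h]
  exact Subalgebra.smul_mem _ (sub_mem hY (Subalgebra.smul_mem _ (one_mem _) _)) _

/-- Expand the square in `X_{n+1} Z_n X_{n+1}²`; the term `X_{n+1} Z_n e_{n+1}` collapses to `Z_n⁻¹
e_{n+1}`. -/
theorem Z_X_mem_middleSpan (n : ℕ) :
    Z p (n + 2) (n + 1) * X p (n + 2) (n + 1) ∈ middleSpan p (n + 1) := by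
  have hk : n + 1 < n + 2 := by omega
  have h : Z p (n + 2) (n + 1) * X p (n + 2) (n + 1) =
      X p (n + 2) (n + 1) * incl p (n + 1) (Z p (n + 1) n) +
        (p.del : R) • Z p (n + 2) (n + 1) - ((p.del : R) * p.lam) •
          (incl p (n + 1) (Zinv p (n + 1) n) * E p (n + 2) (n + 1)) := by
    rw [incl_Z n.lt_succ_self, incl_Zinv n.lt_succ_self, ← X_Z_E hk]
    simp only [Z, mul_assoc]
    rw [X_mul_X (by omega) hk]
    simp only [mul_add, mul_sub, mul_one, mul_smul_comm]
  rw [h]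
  exact sub_mem (add_mem (mul_incl_mem_middleSpan _ (mem_middleSpan (X_mem_middle n)))
    (Submodule.smul_mem _ _ (mem_middleSpan (Z_mem_middle _))))
    (Submodule.smul_mem _ _ (incl_mul_mem_middleSpan _ (mem_middleSpan (E_mem_middle n))))

theorem X_X_mem_middleSpan (n : ℕ) :
    X p (n + 2) (n + 1) * X p (n + 2) (n + 1) ∈ middleSpan p (n + 1) := by
  rw [X_mul_X (by omega) (by omega)]
  exact sub_mem (add_mem (mem_middleSpan (one_mem_middle _))
    (Submodule.smul_mem _ _ (mem_middleSpan (X_mem_middle n))))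
    (Submodule.smul_mem _ _ (mem_middleSpan (E_mem_middle n)))

/-- Here the choice of generators closes up: `X_{n+1} Z_n X_{n+1}` is the next Jucys-Murphy element,
and the other products are rewritten with the top-index generator in the middle. -/
theorem X_middle_X_mem {n : ℕ} {g : BB p (n + 1)} (hg : g ∈ middle p n) :
    X p (n + 2) (n + 1) * incl p (n + 1) g * X p (n + 2) (n + 1) ∈ middleSpan p (n + 1) := by
  rcases hg with rfl | rfl | ⟨hn, rfl | rfl⟩
  · rw [map_one, mul_one]; exact X_X_mem_middleSpan n
  · rw [incl_Z n.lt_succ_self]; exact mem_middleSpan (Z_mem_middle (n + 1))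
  · rw [incl_X hn n.lt_succ_self, mul_assoc, ← braid hn (by omega),
      ← incl_X hn n.lt_succ_self, ← mul_assoc]
    exact mul_mem_middleSpan _ _ (mem_middleSpan (X_mem_middle n))
  · rw [incl_E hn n.lt_succ_self, mul_assoc, X_E_X hn (by omega),
      ← incl_Xinv hn n.lt_succ_self, ← mul_assoc]
    exact mul_mem_middleSpan _ _ (mem_middleSpan (E_mem_middle n))

theorem E_middle_X_mem {n : ℕ} {g : BB p (n + 1)} (hg : g ∈ middle p n) :
    E p (n + 2) (n + 1) * incl p (n + 1) g * X p (n + 2) (n + 1) ∈ middleSpan p (n + 1) := by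
  have hE := mem_middleSpan (E_mem_middle (p := p) n)
  rcases hg with rfl | rfl | ⟨hn, rfl | rfl⟩
  · rw [map_one, mul_one, E_mul_X (by omega) (by omega)]; exact Submodule.smul_mem _ _ hE
  · rw [incl_Z n.lt_succ_self, mul_assoc, E_Z_X (by omega), ← incl_Zinv n.lt_succ_self]
    exact mul_incl_mem_middleSpan _ hE
  · rw [incl_X hn n.lt_succ_self, mul_assoc, E_X_X hn (by omega), ← incl_E hn n.lt_succ_self]
    exact mul_incl_mem_middleSpan _ hE
  · rw [incl_E hn n.lt_succ_self, mul_assoc, E_E_X hn (by omega),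
      ← incl_Xinv hn n.lt_succ_self]
    exact mul_incl_mem_middleSpan _ hE

theorem middleSpan_succ {n : ℕ} (ih : middleSpan p n = ⊤) : middleSpan p (n + 1) = ⊤ := by
  -- By induction `c` is a sum of terms `u g v` with `u`, `v` from `BB_n`. These commute with `x`
  -- and with `X_{n+1}` and move outside, so only `g` has to be treated.
  have key : ∀ x : BB p (n + 2), (∀ a, Commute (incl p (n + 1) (incl p n a)) x) →
      (∀ g ∈ middle p n, x * incl p (n + 1) g * X p (n + 2) (n + 1) ∈ middleSpan p (n + 1)) →
      ∀ c, x * incl p (n + 1) c * X p (n + 2) (n + 1) ∈ middleSpan p (n + 1) := by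
    intro x hx h c
    have hc : c ∈ middleSpan p n := ih ▸ Submodule.mem_top
    induction hc using Submodule.span_induction with
    | mem a ha =>
      obtain ⟨g, hg, u, v, rfl⟩ := ha
      rw [map_mul, map_mul, ← mul_assoc, ← mul_assoc, ← (hx u).eq, mul_assoc _ _ (X p _ _),
        (incl_incl_comm_X n v).eq]
      simpa only [mul_assoc] using mul_mem_middleSpan (incl p n u) (incl p n v) (h g hg)
    | zero => simp
    | add a a' _ _ h h' => rw [map_add, mul_add, add_mul]; exact add_mem h h'
    | smul r a _ h =>
      rw [map_smul, mul_smul_comm, smul_mul_assoc]; exact Submodule.smul_mem _ _ h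
  have hX : X p (n + 2) (n + 1) ∈ rightStabilizer p (n + 1) :=
    mem_rightStabilizer fun g hg c => by
      rcases middle_succ hg with rfl | rfl | rfl | rfl
      · rw [one_mul]; exact incl_mul_mem_middleSpan c (mem_middleSpan (X_mem_middle n))
      · rw [← (incl_comm_Z (n + 1) c).eq, mul_assoc]
        exact incl_mul_mem_middleSpan c (Z_X_mem_middleSpan n)
      · exact key _ (incl_incl_comm_X n) (fun g hg => X_middle_X_mem hg) c
      · exact key _ (incl_incl_comm_E n) (fun g hg => E_middle_X_mem hg) c
  have hE : E p (n + 2) (n + 1) ∈ rightStabilizer p (n + 1) := by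
    -- The formula for `X_{n+1}²` solved for `e_{n+1}`, as `δ λ` is a unit.
    have h : E p (n + 2) (n + 1) = (((p.del * p.lam)⁻¹ : Rˣ) : R) •
        (1 + (p.del : R) • X p (n + 2) (n + 1) - X p (n + 2) (n + 1) * X p (n + 2) (n + 1)) := by
      rw [X_mul_X (by omega) (by omega), sub_sub_cancel, smul_smul, ← Units.val_mul,
        Units.inv_mul, one_smul]
    rw [h]
    exact Subalgebra.smul_mem _ (sub_mem (add_mem (one_mem _) (Subalgebra.smul_mem _ hX _))
      (mul_mem hX hX)) _
  refine middleSpan_eq_top_of_rightStabilizer (mem_of_generators _ (fun _ => ?_) (fun _ => ?_)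
    (fun i h1 h2 => ?_) (fun i h1 h2 => ?_))
  · rw [← incl_Y (by omega)]; exact incl_mem_rightStabilizer _
  · rw [← incl_Yinv (by omega)]; exact incl_mem_rightStabilizer _
  · rcases Nat.lt_succ_iff_lt_or_eq.mp h2 with h | rfl
    · rw [← incl_X h1 h]; exact incl_mem_rightStabilizer _
    · exact hX
  · rcases Nat.lt_succ_iff_lt_or_eq.mp h2 with h | rfl
    · rw [← incl_Xinv h1 h]; exact incl_mem_rightStabilizer _
    · rw [Xinv_eq]
      exact add_mem (sub_mem hX (Subalgebra.smul_mem _ (one_mem _) _))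
        (Subalgebra.smul_mem _ hE _)

variable (p) in
theorem middleSpan_eq_top (n : ℕ) : middleSpan p n = ⊤ := by
  induction n with
  | zero => exact middleSpan_zero
  | succ n ih => exact middleSpan_succ ih

/-- `BB_{n+1}` is generated by `middle` as a bimodule over `BB_n`. -/
theorem middle_induction {n : ℕ} {P : BB p (n + 1) → Prop}
    (add : ∀ a b, P a → P b → P (a + b))
    (mem : ∀ g ∈ middle p n, ∀ b c, P (incl p n b * g * incl p n c)) (a : BB p (n + 1)) :
    P a := by
  have ha : a ∈ middleSpan p n := middleSpan_eq_top p n ▸ Submodule.mem_top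
  rw [middleSpan] at ha
  -- Scalars are absorbed into the left factor, so `P` need only be additive.
  induction ha using Submodule.closure_induction with
  | zero => simpa using mem 1 (one_mem_middle n) 0 0
  | add a b _ _ ha hb => exact add a b ha hb
  | smul_mem r a ha =>
    obtain ⟨g, hg, u, v, rfl⟩ := ha
    simpa only [map_smul, smul_mul_assoc] using mem g hg (r • u) v


/-! ### The conditional expectation -/

theorem isCondExp_iff {a : BB p (m + 1)} {b : BB p m} : IsCondExp p m a b ↔
    E p (m + 2) (m + 1) * (incl p (m + 1) a * E p (m + 2) (m + 1)) =
      (p.x : R) • (incl p (m + 1) (incl p m b) * E p (m + 2) (m + 1)) := by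
  rw [IsCondExp, eTop_eq, mul_assoc]

theorem IsCondExp.add {a a' : BB p (m + 1)} {b b' : BB p m} (h : IsCondExp p m a b)
    (h' : IsCondExp p m a' b') : IsCondExp p m (a + a') (b + b') := by
  rw [isCondExp_iff] at *
  simp only [map_add, add_mul, mul_add, smul_add, h, h']

theorem IsCondExp.smul (r : R) {a : BB p (m + 1)} {b : BB p m} (h : IsCondExp p m a b) :
    IsCondExp p m (r • a) (r • b) := by
  rw [isCondExp_iff] at *
  simp only [map_smul, smul_mul_assoc, mul_smul_comm, h]
  exact smul_comm _ _ _

theorem IsCondExp.sub {a a' : BB p (m + 1)} {b b' : BB p m} (h : IsCondExp p m a b)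
    (h' : IsCondExp p m a' b') : IsCondExp p m (a - a') (b - b') := by
  simpa [sub_eq_add_neg] using h.add (h'.smul (-1))

/-- `e_{m+1}` commutes with the image of `BB_m`, so `u` and `v` can be taken out of the sandwich. -/
theorem IsCondExp.mul_mul (u v : BB p m) {a : BB p (m + 1)} {b : BB p m}
    (h : IsCondExp p m a b) : IsCondExp p m (incl p m u * a * incl p m v) (u * b * v) := by
  rw [isCondExp_iff] at *
  have hu := (incl_incl_comm_E m u).eq
  have hv := (incl_incl_comm_E m v).eq
  simp only [map_mul, mul_assoc]
  rw [hv, ← mul_assoc (E p _ _), ← hu, mul_assoc, ← mul_assoc (incl p (m + 1) a),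
    ← mul_assoc (E p _ _) (_ * _), h, smul_mul_assoc, mul_assoc, mul_smul_comm]

theorem isCondExp_incl (b : BB p m) : IsCondExp p m (incl p m b) b := by
  rw [isCondExp_iff, (incl_incl_comm_E m b).eq, ← mul_assoc, E_mul_E (by omega) (by omega),
    smul_mul_assoc]

theorem isCondExp_one : IsCondExp p m 1 1 := by
  simpa using isCondExp_incl (p := p) (m := m) 1

theorem IsCondExp.of_eq_smul {a : BB p (m + 1)} {r : R}
    (h : E p (m + 2) (m + 1) * (incl p (m + 1) a * E p (m + 2) (m + 1)) =
      r • E p (m + 2) (m + 1)) :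
    IsCondExp p m a ((((p.x⁻¹ : Rˣ) : R) * r) • 1) := by
  rw [isCondExp_iff, h]
  simp [smul_smul]

theorem isCondExp_Y : IsCondExp p 0 (Y p 1) ((((p.x⁻¹ : Rˣ) : R) * p.A) • 1) := by
  refine IsCondExp.of_eq_smul ?_
  have h := mk_rel p 2 (.eYe (by omega) ⟨le_rfl, by omega⟩)
  simp only [map_mul, map_smul, mk_E, mk_Y] at h
  rw [incl_Y le_rfl, ← mul_assoc, h]

theorem isCondExp_X : IsCondExp p (m + 1) (X p (m + 2) (m + 1))
    ((((p.x⁻¹ : Rˣ) : R) * ((p.lam⁻¹ : Rˣ) : R)) • 1) :=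
  IsCondExp.of_eq_smul (by
    rw [incl_X (by omega) (by omega), E_X_E (by omega) (by omega)])

theorem isCondExp_Xinv : IsCondExp p (m + 1) (Xinv p (m + 2) (m + 1))
    ((((p.x⁻¹ : Rˣ) : R) * p.lam) • 1) :=
  IsCondExp.of_eq_smul (by
    rw [incl_Xinv (by omega) (by omega), E_Xinv_E (by omega) (by omega)])

theorem isCondExp_E : IsCondExp p (m + 1) (E p (m + 2) (m + 1)) (((p.x⁻¹ : Rˣ) : R) • 1) := by
  have := IsCondExp.of_eq_smul (p := p) (m := m + 1) (a := E p (m + 2) (m + 1)) (r := 1) (by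
    rw [incl_E (by omega) (by omega), E_E_E (by omega) (by omega), one_smul])
  simpa using this

/-! ### Expectation of products with the top generators -/

/-- The identity behind the behaviour of the conditional expectation under conjugation. -/
theorem E_E_incl_E_E {a : BB p (m + 1)} {b : BB p m} (h : IsCondExp p m a b) :
    E p (m + 3) (m + 2) * (E p (m + 3) (m + 1) * (incl p (m + 2) (incl p (m + 1) a) *
      (E p (m + 3) (m + 1) * E p (m + 3) (m + 2)))) =
    (p.x : R) • (incl p (m + 2) (incl p (m + 1) (incl p m b)) * E p (m + 3) (m + 2)) := by
  rw [isCondExp_iff] at h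
  have h1 := congrArg (incl p (m + 2)) h
  simp only [map_mul, map_smul, incl_E (p := p) (k := m + 2) (i := m + 1) (by omega)
    (by omega)] at h1
  have h2 := congrArg (fun t => E p (m + 3) (m + 2) * (t * E p (m + 3) (m + 2))) h1
  simp only [mul_assoc] at h2
  rw [h2, smul_mul_assoc, mul_smul_comm, mul_assoc, ← mul_assoc (E p _ _),
    ← (incl_incl_comm_E (m + 1) (incl p m b)).eq, mul_assoc, E_E_E (by omega) (by omega)]

/-- Untwisting at the outer `e_{m+2}` replaces `X_{m+1}` and `X_{m+1}⁻¹` by `e_{m+1} X_{m+2}⁻¹` and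
`X_{m+2} e_{m+1}`. The element `a` commutes with `X_{m+2}`, so the two factors cancel. -/
theorem IsCondExp.conj {a : BB p (m + 1)} {b : BB p m} (h : IsCondExp p m a b) :
    IsCondExp p (m + 1) (X p (m + 2) (m + 1) * incl p (m + 1) a * Xinv p (m + 2) (m + 1))
      (incl p m b) := by
  rw [isCondExp_iff, ← E_E_incl_E_E h, map_mul, map_mul, incl_X (by omega) (by omega),
    incl_Xinv (by omega) (by omega)]
  simp only [mul_assoc]
  rw [← X_E_E (by omega) (by omega), ← mul_assoc (E p _ _),
    ← E_E_Xinv (by omega) (by omega)]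
  simp only [mul_assoc]
  rw [← mul_assoc (incl p (m + 2) _), (incl_incl_comm_X (m + 1) a).eq]
  simp only [mul_assoc, Xinv_mul_X_cancel]

theorem IsCondExp.conj' {a : BB p (m + 1)} {b : BB p m} (h : IsCondExp p m a b) :
    IsCondExp p (m + 1) (Xinv p (m + 2) (m + 1) * incl p (m + 1) a * X p (m + 2) (m + 1))
      (incl p m b) := by
  rw [isCondExp_iff, ← E_E_incl_E_E h, map_mul, map_mul, incl_X (by omega) (by omega),
    incl_Xinv (by omega) (by omega)]
  simp only [mul_assoc]
  rw [← Xinv_E_E (by omega) (by omega), ← mul_assoc (E p _ _),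
    ← E_E_X (by omega) (by omega)]
  simp only [mul_assoc]
  rw [← mul_assoc (incl p (m + 2) _), (incl_incl_comm_Xinv (m + 1) a).eq]
  simp only [mul_assoc, X_mul_Xinv_cancel]

theorem IsCondExp.E_mul_E {a : BB p (m + 1)} {b : BB p m} (h : IsCondExp p m a b) :
    IsCondExp p (m + 1) (E p (m + 2) (m + 1) * incl p (m + 1) a * E p (m + 2) (m + 1))
      (incl p m b) := by
  rw [isCondExp_iff, ← E_E_incl_E_E h, map_mul, map_mul, incl_E (by omega) (by omega)]
  simp only [mul_assoc]

/-- Untwisting turns the `X_{m+1}` on one side into `X_{m+2}⁻¹`, which crosses `a` and is untwisted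
back on the other side. -/
theorem isCondExp_E_X_iff {a b : BB p (m + 1)} :
    IsCondExp p (m + 1) (E p (m + 2) (m + 1) * incl p (m + 1) a * X p (m + 2) (m + 1)) b ↔
    IsCondExp p (m + 1) (X p (m + 2) (m + 1) * incl p (m + 1) a * E p (m + 2) (m + 1)) b := by
  simp only [isCondExp_iff, map_mul, mul_assoc]
  rw [incl_X (by omega) (by omega), incl_E (by omega) (by omega),
    ← Xinv_E_E (by omega) (by omega), ← mul_assoc (incl p (m + 2) _) (Xinv p _ _),
    (incl_incl_comm_Xinv (m + 1) a).eq, mul_assoc, ← mul_assoc (E p _ (m + 1)) (Xinv p _ _),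
    ← mul_assoc (E p _ (m + 2)) (_ * _), E_E_Xinv (by omega) (by omega), mul_assoc]

theorem isCondExp_E_Xinv_iff {a b : BB p (m + 1)} :
    IsCondExp p (m + 1) (E p (m + 2) (m + 1) * incl p (m + 1) a * Xinv p (m + 2) (m + 1)) b ↔
    IsCondExp p (m + 1) (Xinv p (m + 2) (m + 1) * incl p (m + 1) a * E p (m + 2) (m + 1)) b := by
  simp only [isCondExp_iff, map_mul, mul_assoc]
  rw [incl_Xinv (by omega) (by omega), incl_E (by omega) (by omega),
    ← X_E_E (by omega) (by omega), ← mul_assoc (incl p (m + 2) _) (X p _ _),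
    (incl_incl_comm_X (m + 1) a).eq, mul_assoc, ← mul_assoc (E p _ (m + 1)) (X p _ _),
    ← mul_assoc (E p _ (m + 2)) (_ * _), E_E_X (by omega) (by omega), mul_assoc]

theorem X_incl_X (a : BB p (m + 1)) :
    X p (m + 2) (m + 1) * incl p (m + 1) a * X p (m + 2) (m + 1) =
      X p (m + 2) (m + 1) * incl p (m + 1) a * Xinv p (m + 2) (m + 1) +
        (p.del : R) • (X p (m + 2) (m + 1) * incl p (m + 1) a) -
        (p.del : R) • (X p (m + 2) (m + 1) * incl p (m + 1) a * E p (m + 2) (m + 1)) := by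
  nth_rewrite 2 [X_eq]
  simp only [mul_add, mul_sub, mul_smul_comm, mul_one]

theorem isCondExp_X_incl (a : BB p (m + 1)) :
    IsCondExp p (m + 1) (X p (m + 2) (m + 1) * incl p (m + 1) a)
      ((((p.x⁻¹ : Rˣ) : R) * ((p.lam⁻¹ : Rˣ) : R)) • a) := by
  simpa using isCondExp_X.mul_mul (p := p) (m := m + 1) 1 a

theorem isCondExp_E_incl (a : BB p (m + 1)) :
    IsCondExp p (m + 1) (E p (m + 2) (m + 1) * incl p (m + 1) a) (((p.x⁻¹ : Rˣ) : R) • a) := by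
  simpa using isCondExp_E.mul_mul (p := p) (m := m + 1) 1 a

theorem isCondExp_incl_X (a : BB p (m + 1)) :
    IsCondExp p (m + 1) (incl p (m + 1) a * X p (m + 2) (m + 1))
      ((((p.x⁻¹ : Rˣ) : R) * ((p.lam⁻¹ : Rˣ) : R)) • a) := by
  simpa using isCondExp_X.mul_mul (p := p) (m := m + 1) a 1

theorem isCondExp_incl_Xinv (a : BB p (m + 1)) :
    IsCondExp p (m + 1) (incl p (m + 1) a * Xinv p (m + 2) (m + 1))
      ((((p.x⁻¹ : Rˣ) : R) * p.lam) • a) := by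
  simpa using isCondExp_Xinv.mul_mul (p := p) (m := m + 1) a 1

theorem isCondExp_incl_E (a : BB p (m + 1)) :
    IsCondExp p (m + 1) (incl p (m + 1) a * E p (m + 2) (m + 1)) (((p.x⁻¹ : Rˣ) : R) • a) := by
  simpa using isCondExp_E.mul_mul (p := p) (m := m + 1) a 1

theorem X_incl_Z_E : X p (m + 2) (m + 1) * incl p (m + 1) (Z p (m + 1) m) *
    E p (m + 2) (m + 1) = incl p (m + 1) (Zinv p (m + 1) m) * E p (m + 2) (m + 1) := by
  rw [incl_Z m.lt_succ_self, incl_Zinv m.lt_succ_self, mul_assoc, X_Z_E (by omega)]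

/-- In `X Z_m X` the right factor is replaced by `X⁻¹ + δ - δ e`. Conjugation preserves the
expectation, and the other two terms are `X Z_m` and `X Z_m e = Z_m⁻¹ e`. -/
theorem exists_isCondExp_Z (m : ℕ) : ∃ b, IsCondExp p m (Z p (m + 1) m) b := by
  induction m with
  | zero => exact ⟨_, isCondExp_Y⟩
  | succ m ih =>
    obtain ⟨b, hb⟩ := ih
    have h := X_incl_X (p := p) (Z p (m + 1) m)
    rw [X_incl_Z_E] at h
    rw [Z, ← incl_Z m.lt_succ_self, h]
    exact ⟨_, (hb.conj.add ((isCondExp_X_incl _).smul _)).sub ((isCondExp_incl_E _).smul _)⟩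

theorem exists_isCondExp (a : BB p (m + 1)) : ∃ b, IsCondExp p m a b := by
  induction a using middle_induction with
  | add a b ha hb =>
    obtain ⟨a', ha⟩ := ha
    obtain ⟨b', hb⟩ := hb
    exact ⟨_, ha.add hb⟩
  | mem g hg u v =>
    suffices h : ∃ b, IsCondExp p m g b from ⟨_, h.choose_spec.mul_mul u v⟩
    rcases hg with rfl | rfl | ⟨hm, hg⟩
    · exact ⟨_, isCondExp_one⟩
    · exact exists_isCondExp_Z m
    · obtain ⟨m, rfl⟩ : ∃ l, m = l + 1 := ⟨m - 1, by omega⟩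
      rcases hg with rfl | rfl
      · exact ⟨_, isCondExp_X⟩
      · exact ⟨_, isCondExp_E⟩

/-! ### Uniqueness and the bimodule property -/

theorem isCondExp_condExp (a : BB p (m + 1)) : IsCondExp p m a (condExp p m a) := by
  rw [condExp, dif_pos (exists_isCondExp a)]
  exact (exists_isCondExp a).choose_spec

theorem IsCondExp.condExp_eq (hm : Function.Injective (wenzlMap p m)) {a : BB p (m + 1)}
    {b : BB p m} (h : IsCondExp p m a b) : condExp p m a = b := by
  apply hm
  have h1 := (isCondExp_condExp a).symm.trans h
  -- One factor `x⁻¹` cancels the `x` of the defining equation, the other is the one in `wenzlMap`.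
  have h2 := congrArg (fun t => (((p.x⁻¹ * p.x⁻¹ : Rˣ)) : R) • t) h1
  simpa [wenzlMap, smul_smul, mul_assoc] using h2

theorem isCondExp_iff_eq_condExp (hm : Function.Injective (wenzlMap p m)) (a : BB p (m + 1))
    (b : BB p m) : IsCondExp p m a b ↔ b = condExp p m a :=
  ⟨fun h => (h.condExp_eq hm).symm, fun h => h ▸ isCondExp_condExp a⟩

theorem condExp_add (hm : Function.Injective (wenzlMap p m))
    (a b : BB p (m + 1)) :
    condExp p m (a + b) = condExp p m a + condExp p m b :=
  ((isCondExp_condExp a).add (isCondExp_condExp b)).condExp_eq hm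

theorem condExp_smul (hm : Function.Injective (wenzlMap p m))
    (r : R) (a : BB p (m + 1)) :
    condExp p m (r • a) = r • condExp p m a :=
  ((isCondExp_condExp a).smul r).condExp_eq hm

theorem condExp_mul_incl (hm : Function.Injective (wenzlMap p m))
    (a : BB p (m + 1)) (v : BB p m) :
    condExp p m (a * incl p m v) = condExp p m a * v := by
  simpa using ((isCondExp_condExp a).mul_mul 1 v).condExp_eq hm

theorem condExp_incl_mul (hm : Function.Injective (wenzlMap p m))
    (u : BB p m) (a : BB p (m + 1)) :
    condExp p m (incl p m u * a) = u * condExp p m a := by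
  simpa using ((isCondExp_condExp a).mul_mul u 1).condExp_eq hm


/-! ### The twisted expectation `a ↦ ε(X a e)` -/

variable (p m) in
/-- The map `a ↦ ε(X_{m+1} a e_{m+1})` of `BB_{m+1}` to itself. -/
def psi (a : BB p (m + 1)) : BB p (m + 1) :=
  condExp p (m + 1) (X p (m + 2) (m + 1) * incl p (m + 1) a * E p (m + 2) (m + 1))

theorem isCondExp_psi (a : BB p (m + 1)) : IsCondExp p (m + 1)
    (X p (m + 2) (m + 1) * incl p (m + 1) a * E p (m + 2) (m + 1)) (psi p m a) :=
  isCondExp_condExp _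

theorem isCondExp_psi' (a : BB p (m + 1)) : IsCondExp p (m + 1)
    (E p (m + 2) (m + 1) * incl p (m + 1) a * X p (m + 2) (m + 1)) (psi p m a) :=
  isCondExp_E_X_iff.2 (isCondExp_psi a)

theorem psi_eq (hm : Function.Injective (wenzlMap p (m + 1))) {a b : BB p (m + 1)}
    (h : IsCondExp p (m + 1)
      (E p (m + 2) (m + 1) * incl p (m + 1) a * X p (m + 2) (m + 1)) b) : psi p m a = b :=
  (isCondExp_E_X_iff.1 h).condExp_eq hm

theorem psi_add (hm : Function.Injective (wenzlMap p (m + 1))) (a b : BB p (m + 1)) :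
    psi p m (a + b) = psi p m a + psi p m b := by
  simp only [psi, map_add, mul_add, add_mul, condExp_add hm]

theorem psi_mul_mul (hm : Function.Injective (wenzlMap p (m + 1))) (u v : BB p m)
    (a : BB p (m + 1)) :
    psi p m (incl p m u * a * incl p m v) = incl p m u * psi p m a * incl p m v := by
  have hu := (incl_incl_comm_X m u).eq
  have hv := (incl_incl_comm_E m v).eq
  rw [psi, map_mul, map_mul, ← mul_assoc, ← mul_assoc, ← hu, mul_assoc _ _ (E p _ _), hv]
  have h := ((isCondExp_psi a).mul_mul (incl p m u) (incl p m v)).condExp_eq hm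
  simpa only [mul_assoc] using h

/-- This and the next three lemmas tabulate `ψ` on the bimodule generators. They compute `ε(e a X)`,
which equals `ε(X a e)`, since there the relations for `e a X` apply directly. -/
theorem psi_one (hm : Function.Injective (wenzlMap p (m + 1))) :
    psi p m 1 = (((p.x⁻¹ : Rˣ) : R) * p.lam) • 1 := by
  refine psi_eq hm ?_
  rw [map_one, mul_one, E_mul_X (by omega) (by omega), mul_comm, mul_smul]
  exact isCondExp_E.smul _

theorem psi_X (hm : Function.Injective (wenzlMap p (m + 2))) :
    psi p (m + 1) (X p (m + 2) (m + 1)) = ((p.x⁻¹ : Rˣ) : R) • E p (m + 2) (m + 1) := by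
  refine psi_eq hm ?_
  rw [incl_X (by omega) (by omega), mul_assoc, E_X_X (by omega) (by omega),
    ← incl_E (i := m + 1) (by omega) (by omega)]
  exact isCondExp_E_incl _

theorem psi_E (hm : Function.Injective (wenzlMap p (m + 2))) :
    psi p (m + 1) (E p (m + 2) (m + 1)) = ((p.x⁻¹ : Rˣ) : R) • Xinv p (m + 2) (m + 1) := by
  refine psi_eq hm ?_
  rw [incl_E (by omega) (by omega), mul_assoc, E_E_X (by omega) (by omega),
    ← incl_Xinv (by omega) (by omega)]
  exact isCondExp_E_incl _

theorem psi_Z (hm : Function.Injective (wenzlMap p (m + 1))) :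
    psi p m (Z p (m + 1) m) = ((p.x⁻¹ : Rˣ) : R) • Zinv p (m + 1) m := by
  refine psi_eq hm ?_
  rw [incl_Z (by omega), mul_assoc, E_Z_X (by omega), ← incl_Zinv (by omega)]
  exact isCondExp_E_incl _

/-- `e Z⁻¹ = e Z X`, and the `X` is absorbed by the right-hand `e` with factor `λ`. -/
theorem condExp_Zinv (hm : Function.Injective (wenzlMap p m)) :
    condExp p m (Zinv p (m + 1) m) = (p.lam : R) • condExp p m (Z p (m + 1) m) := by
  refine IsCondExp.condExp_eq hm ?_
  have h := (isCondExp_condExp (Z p (m + 1) m)).smul (p.lam : R)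
  rw [isCondExp_iff] at h ⊢
  rw [← h, map_smul, incl_Z (by omega), incl_Zinv (by omega), ← mul_assoc,
    ← E_Z_X (by omega), mul_assoc, mul_assoc, X_mul_E (by omega) (by omega), smul_mul_assoc,
    mul_smul_comm]

/-- As `ψ(1) = x⁻¹ λ`, this is the symmetry of `ψ` with one argument equal to `1`. It is read off
from the table on generators. -/
theorem condExp_psi (h0 : Function.Injective (wenzlMap p m))
    (h1 : Function.Injective (wenzlMap p (m + 1))) (c : BB p (m + 1)) :
    condExp p m (psi p m c) = (((p.x⁻¹ : Rˣ) : R) * p.lam) • condExp p m c := by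
  induction c using middle_induction with
  | add a b ha hb => rw [psi_add h1, condExp_add h0, condExp_add h0, ha, hb, smul_add]
  | mem g hg u v =>
    rw [psi_mul_mul h1, condExp_mul_incl h0, condExp_mul_incl h0, condExp_incl_mul h0,
      condExp_incl_mul h0]
    suffices h : condExp p m (psi p m g) = (((p.x⁻¹ : Rˣ) : R) * p.lam) • condExp p m g by
      rw [h, mul_smul_comm, smul_mul_assoc]
    rcases hg with rfl | rfl | ⟨hm, hg⟩
    · rw [psi_one h1, condExp_smul h0]
    · rw [psi_Z h1, condExp_smul h0, condExp_Zinv h0, smul_smul]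
    · obtain ⟨m, rfl⟩ : ∃ l, m = l + 1 := ⟨m - 1, by omega⟩
      rcases hg with rfl | rfl
      · rw [psi_X h1, condExp_smul h0, isCondExp_X.condExp_eq h0, isCondExp_E.condExp_eq h0,
          smul_smul, smul_smul]
        congr 1
        linear_combination -((p.x⁻¹ : Rˣ) : R) * ((p.x⁻¹ : Rˣ) : R) * p.lam.mul_inv
      · rw [psi_E h1, condExp_smul h0, isCondExp_Xinv.condExp_eq h0,
          isCondExp_E.condExp_eq h0, smul_smul, smul_smul]
        congr 1
        ring

theorem Xinv_Zinv_E (hk : i + 1 < k) :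
    Xinv p k (i + 1) * (Zinv p k i * E p k (i + 1)) = Z p k i * E p k (i + 1) := by
  rw [← X_Z_E hk, Xinv_mul_X_cancel]

/-- Both sides equal `x⁻¹ λ Z_m⁻¹`. This and the next three lemmas settle the pairs of one
Jucys-Murphy element with `X` or `e` in the symmetry of `ψ`. -/
theorem condExp_E_Z (h1 : Function.Injective (wenzlMap p (m + 1))) :
    condExp p (m + 1) (E p (m + 2) (m + 1) * Z p (m + 2) (m + 1)) =
      condExp p (m + 1) (X p (m + 2) (m + 1) * Zinv p (m + 2) (m + 1)) := by
  have hE : E p (m + 2) (m + 1) * Z p (m + 2) (m + 1) =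
      (p.lam : R) • (E p (m + 2) (m + 1) * incl p (m + 1) (Zinv p (m + 1) m)) := by
    rw [Z, ← mul_assoc, ← mul_assoc, E_mul_X (by omega) (by omega), smul_mul_assoc,
      smul_mul_assoc, mul_assoc, E_Z_X (by omega), incl_Zinv (by omega)]
  have hX : X p (m + 2) (m + 1) * Zinv p (m + 2) (m + 1) =
      incl p (m + 1) (Zinv p (m + 1) m) * Xinv p (m + 2) (m + 1) := by
    rw [Zinv, ← mul_assoc, X_mul_Xinv_cancel, incl_Zinv (by omega)]
  rw [hE, hX, ((isCondExp_E_incl _).smul _).condExp_eq h1,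
    (isCondExp_incl_Xinv _).condExp_eq h1, smul_smul, mul_comm]

theorem condExp_Z_E (h1 : Function.Injective (wenzlMap p (m + 1))) :
    condExp p (m + 1) (Z p (m + 2) (m + 1) * E p (m + 2) (m + 1)) =
      condExp p (m + 1) (Zinv p (m + 2) (m + 1) * X p (m + 2) (m + 1)) := by
  have hE : Z p (m + 2) (m + 1) * E p (m + 2) (m + 1) =
      (p.lam : R) • (incl p (m + 1) (Zinv p (m + 1) m) * E p (m + 2) (m + 1)) := by
    rw [Z, mul_assoc, X_mul_E (by omega) (by omega), mul_smul_comm, mul_assoc,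
      X_Z_E (by omega), incl_Zinv (by omega)]
  have hX : Zinv p (m + 2) (m + 1) * X p (m + 2) (m + 1) =
      Xinv p (m + 2) (m + 1) * incl p (m + 1) (Zinv p (m + 1) m) := by
    rw [Zinv, mul_assoc, Xinv_mul_X, mul_one, incl_Zinv (by omega)]
  rw [hE, hX, ((isCondExp_incl_E _).smul _).condExp_eq h1, condExp_mul_incl h1,
    isCondExp_Xinv.condExp_eq h1, smul_mul_assoc, one_mul, smul_smul, mul_comm]

theorem condExp_Xinv_Z (h1 : Function.Injective (wenzlMap p (m + 1))) :
    condExp p (m + 1) (Xinv p (m + 2) (m + 1) * Z p (m + 2) (m + 1)) =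
      condExp p (m + 1) (E p (m + 2) (m + 1) * Zinv p (m + 2) (m + 1)) := by
  have hX : Xinv p (m + 2) (m + 1) * Z p (m + 2) (m + 1) =
      incl p (m + 1) (Z p (m + 1) m) * X p (m + 2) (m + 1) := by
    rw [Z, mul_assoc, Xinv_mul_X_cancel, incl_Z (by omega)]
  have hE : E p (m + 2) (m + 1) * Zinv p (m + 2) (m + 1) =
      ((p.lam⁻¹ : Rˣ) : R) • (E p (m + 2) (m + 1) * incl p (m + 1) (Z p (m + 1) m)) := by
    rw [Zinv, ← mul_assoc, ← mul_assoc, E_mul_Xinv (by omega) (by omega), smul_mul_assoc,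
      smul_mul_assoc, mul_assoc, E_Zinv_Xinv (by omega), incl_Z (by omega)]
  rw [hE, hX, ((isCondExp_E_incl _).smul _).condExp_eq h1,
    (isCondExp_incl_X _).condExp_eq h1, smul_smul, mul_comm]

theorem condExp_Z_Xinv (h1 : Function.Injective (wenzlMap p (m + 1))) :
    condExp p (m + 1) (Z p (m + 2) (m + 1) * Xinv p (m + 2) (m + 1)) =
      condExp p (m + 1) (Zinv p (m + 2) (m + 1) * E p (m + 2) (m + 1)) := by
  have hX : Z p (m + 2) (m + 1) * Xinv p (m + 2) (m + 1) =
      X p (m + 2) (m + 1) * incl p (m + 1) (Z p (m + 1) m) := by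
    rw [Z, mul_assoc, X_mul_Xinv, mul_one, incl_Z (by omega)]
  have hE : Zinv p (m + 2) (m + 1) * E p (m + 2) (m + 1) =
      ((p.lam⁻¹ : Rˣ) : R) • (incl p (m + 1) (Z p (m + 1) m) * E p (m + 2) (m + 1)) := by
    rw [Zinv, mul_assoc, Xinv_mul_E (by omega) (by omega), mul_smul_comm, mul_assoc,
      Xinv_Zinv_E (by omega), incl_Z (by omega)]
  rw [hE, hX, ((isCondExp_incl_E _).smul _).condExp_eq h1,
    (isCondExp_X_incl _).condExp_eq h1, smul_smul, mul_comm]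

theorem condExp_psi_mul_one (h0 : Function.Injective (wenzlMap p m))
    (h1 : Function.Injective (wenzlMap p (m + 1))) (g : BB p (m + 1)) (s : BB p m) :
    condExp p m (psi p m g * incl p m s * 1) = condExp p m (g * incl p m s * psi p m 1) := by
  rw [psi_one h1, mul_smul_comm, condExp_smul h0, mul_one, mul_one, condExp_mul_incl h0,
    condExp_mul_incl h0, condExp_psi h0 h1, smul_mul_assoc]

theorem condExp_one_mul_psi (h0 : Function.Injective (wenzlMap p m))
    (h1 : Function.Injective (wenzlMap p (m + 1))) (g : BB p (m + 1)) (s : BB p m) :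
    condExp p m (psi p m 1 * incl p m s * g) = condExp p m (1 * incl p m s * psi p m g) := by
  rw [psi_one h1, smul_mul_assoc, smul_mul_assoc, condExp_smul h0, one_mul, condExp_incl_mul h0,
    condExp_incl_mul h0, condExp_psi h0 h1, mul_smul_comm]

theorem condExp_psi_Z_mul_Z (h0 : Function.Injective (wenzlMap p m))
    (h1 : Function.Injective (wenzlMap p (m + 1))) (s : BB p m) :
    condExp p m (psi p m (Z p (m + 1) m) * incl p m s * Z p (m + 1) m) =
      condExp p m (Z p (m + 1) m * incl p m s * psi p m (Z p (m + 1) m)) := by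
  rw [psi_Z h1, smul_mul_assoc, smul_mul_assoc, mul_smul_comm, condExp_smul h0,
    condExp_smul h0, mul_assoc, mul_assoc, (incl_comm_Z m s).eq, (incl_comm_Zinv m s).eq,
    Zinv_mul_Z_cancel, Z_mul_Zinv_cancel]

/-- The twisted expectation is symmetric for the pairing `(a, b) ↦ ε(a s b)` on the elements
that generate the bimodule `BB_{m+1}`. -/
theorem condExp_psi_middle (h0 : Function.Injective (wenzlMap p m))
    (h1 : Function.Injective (wenzlMap p (m + 1))) {g g' : BB p (m + 1)}
    (hg : g ∈ middle p m) (hg' : g' ∈ middle p m) (s : BB p m) :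
    condExp p m (psi p m g * incl p m s * g') = condExp p m (g * incl p m s * psi p m g') := by
  rcases m with _ | m
  · rcases middle_zero hg with rfl | rfl
    · exact condExp_one_mul_psi h0 h1 _ s
    rcases middle_zero hg' with rfl | rfl
    · exact condExp_psi_mul_one h0 h1 _ s
    · exact condExp_psi_Z_mul_Z h0 h1 s
  have hZ := (incl_comm_Z (m + 1) s).eq
  have hZinv := (incl_comm_Zinv (m + 1) s).eq
  rcases middle_succ hg with rfl | rfl | rfl | rfl
  · exact condExp_one_mul_psi h0 h1 _ s
  · rcases middle_succ hg' with rfl | rfl | rfl | rfl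
    · exact condExp_psi_mul_one h0 h1 _ s
    · exact condExp_psi_Z_mul_Z h0 h1 s
    · rw [psi_Z h1, psi_X h1, smul_mul_assoc, smul_mul_assoc, mul_smul_comm, condExp_smul h0,
        condExp_smul h0, ← hZ, ← hZinv, mul_assoc, mul_assoc, condExp_incl_mul h0,
        condExp_incl_mul h0, condExp_Z_E h0]
    · rw [psi_Z h1, psi_E h1, smul_mul_assoc, smul_mul_assoc, mul_smul_comm, condExp_smul h0,
        condExp_smul h0, ← hZ, ← hZinv, mul_assoc, mul_assoc, condExp_incl_mul h0,
        condExp_incl_mul h0, condExp_Z_Xinv h0]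
  · rcases middle_succ hg' with rfl | rfl | rfl | rfl
    · exact condExp_psi_mul_one h0 h1 _ s
    · rw [psi_Z h1, psi_X h1, smul_mul_assoc, smul_mul_assoc, mul_smul_comm, condExp_smul h0,
        condExp_smul h0, mul_assoc, mul_assoc, hZ, hZinv, ← mul_assoc, ← mul_assoc,
        condExp_mul_incl h0, condExp_mul_incl h0, condExp_E_Z h0]
    -- The pair `X`, `X` asks for `ε(e s X) = ε(X s e)`.
    · rw [psi_X h1, smul_mul_assoc, smul_mul_assoc, mul_smul_comm, condExp_smul h0,
        condExp_smul h0, (isCondExp_psi' s).condExp_eq h0, (isCondExp_psi s).condExp_eq h0]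
    -- The pair `X`, `e`: both `ε(e s e)` and `ε(X s X⁻¹)` are the image of `ε(s)`.
    · rw [psi_X h1, psi_E h1, smul_mul_assoc, smul_mul_assoc, mul_smul_comm, condExp_smul h0,
        condExp_smul h0, (isCondExp_condExp s).E_mul_E.condExp_eq h0,
        (isCondExp_condExp s).conj.condExp_eq h0]
  · rcases middle_succ hg' with rfl | rfl | rfl | rfl
    · exact condExp_psi_mul_one h0 h1 _ s
    · rw [psi_Z h1, psi_E h1, smul_mul_assoc, smul_mul_assoc, mul_smul_comm, condExp_smul h0,
        condExp_smul h0, mul_assoc, mul_assoc, hZ, hZinv, ← mul_assoc, ← mul_assoc,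
        condExp_mul_incl h0, condExp_mul_incl h0, condExp_Xinv_Z h0]
    · rw [psi_X h1, psi_E h1, smul_mul_assoc, smul_mul_assoc, mul_smul_comm, condExp_smul h0,
        condExp_smul h0, (isCondExp_condExp s).E_mul_E.condExp_eq h0,
        (isCondExp_condExp s).conj'.condExp_eq h0]
    · rw [psi_E h1, smul_mul_assoc, smul_mul_assoc, mul_smul_comm, condExp_smul h0,
        condExp_smul h0,
        (isCondExp_E_Xinv_iff.2 (isCondExp_condExp _)).condExp_eq h0]

/-! ### The trace property -/

theorem tr_succ (a : BB p (m + 1)) : tr p (m + 1) a = tr p m (condExp p m a) := rfl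

/-- Self-adjointness of `ψ`, the crux of the trace property. Both arguments are decomposed over
`BB_m`, where `ψ` is bilinear, leaving the table of generators. -/
theorem tr_psi_mul (h0 : Function.Injective (wenzlMap p m))
    (h1 : Function.Injective (wenzlMap p (m + 1))) (ht : IsTrace (tr p (m + 1)))
    (b c : BB p (m + 1)) :
    tr p (m + 1) (psi p m b * c) = tr p (m + 1) (b * psi p m c) := by
  induction b using middle_induction with
  | add a b ha hb => rw [psi_add h1, add_mul, add_mul, ht.1.map_add, ht.1.map_add, ha, hb]
  | mem g hg u v =>
    induction c using middle_induction with
    | add a b ha hb => rw [psi_add h1, mul_add, mul_add, ht.1.map_add, ht.1.map_add, ha, hb]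
    | mem g' hg' u' v' =>
      -- Cyclicity carries `u` to the far right, after which `ε` takes `v' u` out.
      have key : ∀ a b : BB p (m + 1),
          tr p (m + 1) (incl p m u * a * incl p m v * (incl p m u' * b * incl p m v')) =
            tr p m (condExp p m (a * incl p m (v * u') * b) * (v' * u)) := fun a b => by
        rw [← condExp_mul_incl h0, ← tr_succ, map_mul, map_mul]
        simp only [mul_assoc]
        rw [ht.2]
        simp only [mul_assoc]
      rw [psi_mul_mul h1, psi_mul_mul h1, key, key, condExp_psi_middle h0 h1 hg hg']

/-- Writes `b ↦ ε(X b X)` as a combination of `ε`, the identity and `ψ`, each self-adjoint for the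
trace form. -/
theorem condExp_X_X (h1 : Function.Injective (wenzlMap p (m + 1))) (a : BB p (m + 1)) :
    condExp p (m + 1) (X p (m + 2) (m + 1) * incl p (m + 1) a * X p (m + 2) (m + 1)) =
      incl p m (condExp p m a) +
        (p.del : R) • (((p.x⁻¹ : Rˣ) : R) * ((p.lam⁻¹ : Rˣ) : R)) • a -
        (p.del : R) • psi p m a := by
  rw [X_incl_X]
  exact (((isCondExp_condExp a).conj.add ((isCondExp_X_incl a).smul _)).sub
    ((isCondExp_psi a).smul _)).condExp_eq h1

theorem tr_condExp_X_X_mul (h0 : Function.Injective (wenzlMap p m))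
    (h1 : Function.Injective (wenzlMap p (m + 1))) (ht : IsTrace (tr p (m + 1)))
    (b c : BB p (m + 1)) :
    tr p (m + 1) (condExp p (m + 1)
      (X p (m + 2) (m + 1) * incl p (m + 1) b * X p (m + 2) (m + 1)) * c) =
    tr p (m + 1) (b * condExp p (m + 1)
      (X p (m + 2) (m + 1) * incl p (m + 1) c * X p (m + 2) (m + 1))) := by
  have h : tr p (m + 1) (incl p m (condExp p m b) * c) =
      tr p (m + 1) (b * incl p m (condExp p m c)) := by
    rw [tr_succ, tr_succ, condExp_incl_mul h0, condExp_mul_incl h0]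
  simp only [condExp_X_X h1, add_mul, mul_add, sub_mul, mul_sub, smul_mul_assoc, mul_smul_comm,
    ht.1.map_add, ht.1.map_sub, ht.1.map_smul, h, tr_psi_mul h0 h1 ht]

/-- Expanding `X²` in `X² Z_m X` and `X Z_m X²` leaves terms that agree after `ε`; for `e Z_m X` and
`X Z_m e` both expectations are `ψ(Z_m)`. -/
theorem condExp_X_Z (h1 : Function.Injective (wenzlMap p (m + 1))) :
    condExp p (m + 1) (X p (m + 2) (m + 1) * Z p (m + 2) (m + 1)) =
      condExp p (m + 1) (Z p (m + 2) (m + 1) * X p (m + 2) (m + 1)) := by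
  have hl : X p (m + 2) (m + 1) * Z p (m + 2) (m + 1) =
      incl p (m + 1) (Z p (m + 1) m) * X p (m + 2) (m + 1) +
        (p.del : R) • Z p (m + 2) (m + 1) - ((p.del : R) * p.lam) •
          (E p (m + 2) (m + 1) * incl p (m + 1) (Z p (m + 1) m) * X p (m + 2) (m + 1)) := by
    rw [incl_Z (by omega), Z, ← mul_assoc, ← mul_assoc, X_mul_X (by omega) (by omega)]
    simp only [add_mul, sub_mul, one_mul, smul_mul_assoc]
  have hr : Z p (m + 2) (m + 1) * X p (m + 2) (m + 1) =
      X p (m + 2) (m + 1) * incl p (m + 1) (Z p (m + 1) m) +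
        (p.del : R) • Z p (m + 2) (m + 1) - ((p.del : R) * p.lam) •
          (X p (m + 2) (m + 1) * incl p (m + 1) (Z p (m + 1) m) * E p (m + 2) (m + 1)) := by
    rw [incl_Z (by omega), Z, mul_assoc _ (X p _ _) (X p _ _), X_mul_X (by omega) (by omega)]
    simp only [mul_add, mul_sub, mul_one, mul_smul_comm]
  rw [hl, hr, (((isCondExp_incl_X _).add ((isCondExp_condExp _).smul _)).sub
    ((isCondExp_psi' _).smul _)).condExp_eq h1, (((isCondExp_X_incl _).add
    ((isCondExp_condExp _).smul _)).sub ((isCondExp_psi _).smul _)).condExp_eq h1]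

theorem tr_incl_mul_comm (h1 : Function.Injective (wenzlMap p m)) (ht : IsTrace (tr p m))
    (u : BB p m) (a : BB p (m + 1)) :
    tr p (m + 1) (incl p m u * a) = tr p (m + 1) (a * incl p m u) := by
  rw [tr_succ, tr_succ, condExp_incl_mul h1, condExp_mul_incl h1, ht.2]

theorem isLinearMap_tr_succ (h1 : Function.Injective (wenzlMap p m))
    (ht : IsLinearMap R (tr p m)) : IsLinearMap R (tr p (m + 1)) where
  map_add a b := by rw [tr_succ, condExp_add h1, ht.map_add]; rfl
  map_smul r a := by rw [tr_succ, condExp_smul h1, ht.map_smul]; rfl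

theorem tr_X_mul_comm (h0 : Function.Injective (wenzlMap p m))
    (h1 : Function.Injective (wenzlMap p (m + 1))) (ht : IsTrace (tr p (m + 1)))
    (a : BB p (m + 2)) :
    tr p (m + 2) (X p (m + 2) (m + 1) * a) = tr p (m + 2) (a * X p (m + 2) (m + 1)) := by
  have hl := isLinearMap_tr_succ h1 ht.1
  induction a using middle_induction with
  | add a b ha hb => rw [mul_add, add_mul, hl.map_add, hl.map_add, ha, hb]
  | mem g hg u v =>
    -- The outer factors leave `ε`, and the goal becomes `tr(ε(X u g) v) = tr(u ε(g v X))`.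
    rw [← mul_assoc, ← mul_assoc, tr_succ, condExp_mul_incl h1, mul_assoc (incl p _ u),
      mul_assoc (incl p _ u), tr_succ (m := m + 1), condExp_incl_mul h1]
    rcases middle_succ hg with rfl | rfl | rfl | rfl
    · rw [mul_one, one_mul, (isCondExp_X_incl u).condExp_eq h1,
        (isCondExp_incl_X v).condExp_eq h1, smul_mul_assoc, mul_smul_comm]
    -- `Z` commutes with `u` and `v`, so the sides are `tr(ε(X Z) u v)` and `tr(u v ε(Z X))`.
    · rw [mul_assoc, (incl_comm_Z (m + 1) u).eq, ← mul_assoc, condExp_mul_incl h1,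
        ← (incl_comm_Z (m + 1) v).eq, mul_assoc (incl p _ v), condExp_incl_mul h1,
        condExp_X_Z h1, mul_assoc, ht.2, mul_assoc]
    · exact tr_condExp_X_X_mul h0 h1 ht u v
    · rw [(isCondExp_psi u).condExp_eq h1, (isCondExp_psi' v).condExp_eq h1,
        tr_psi_mul h0 h1 ht]

theorem isTrace_tr_succ (h0 : Function.Injective (wenzlMap p m))
    (h1 : Function.Injective (wenzlMap p (m + 1))) (ht : IsTrace (tr p (m + 1))) :
    IsTrace (tr p (m + 2)) := by
  have hl := isLinearMap_tr_succ h1 ht.1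
  refine ⟨hl, ?_⟩
  let S : Subalgebra R (BB p (m + 2)) :=
    { carrier := {x | ∀ a, tr p (m + 2) (x * a) = tr p (m + 2) (a * x)}
      mul_mem' := fun {x y} hx hy a => by
        rw [mul_assoc, hx, mul_assoc, hy, mul_assoc]
      add_mem' := fun {x y} hx hy a => by
        rw [add_mul, mul_add, hl.map_add, hl.map_add, hx, hy]
      algebraMap_mem' := fun r a => by rw [Algebra.commutes] }
  have hincl : ∀ u, incl p (m + 1) u ∈ S := fun u a => tr_incl_mul_comm h1 ht u a
  have hX : X p (m + 2) (m + 1) ∈ S := tr_X_mul_comm h0 h1 ht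
  have hXinv : Xinv p (m + 2) (m + 1) ∈ S := fun a => by
    -- Applying the property of `X` to `X⁻¹ a X⁻¹` gives that of `X⁻¹`.
    have h := hX (Xinv p (m + 2) (m + 1) * a * Xinv p (m + 2) (m + 1))
    rw [mul_assoc _ _ (X p _ _), Xinv_mul_X, mul_one, mul_assoc, X_mul_Xinv_cancel] at h
    exact h.symm
  refine mem_of_generators S (fun _ => ?_) (fun _ => ?_) (fun i h1 h2 => ?_)
    (fun i h1 h2 => ?_)
  · rw [← incl_Y (by omega)]; exact hincl _
  · rw [← incl_Yinv (by omega)]; exact hincl _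
  · rcases Nat.lt_succ_iff_lt_or_eq.mp h2 with h | rfl
    · rw [← incl_X h1 h]; exact hincl _
    · exact hX
  · rcases Nat.lt_succ_iff_lt_or_eq.mp h2 with h | rfl
    · rw [← incl_Xinv h1 h]; exact hincl _
    · exact hXinv

end BB
end

theorem mainTheorem7 {R : Type u} [CommRing R] [IsDomain R] (p : BBParams R) (n : ℕ)
    (hn : 1 ≤ n)
    (hinj : ∀ m ≤ n, Function.Injective (BB.wenzlMap p m))
    (hI : IsSemisimpleNonUnital (BB.idealI p n hn))
    (htr : BB.IsTrace (BB.tr p n)) :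
    (∀ m ≤ n, ∀ (a : BB p (m + 1)) (b : BB p m),
      BB.IsCondExp p m a b ↔ b = BB.condExp p m a) ∧
    BB.IsTrace (BB.tr p (n + 1)) := by
  refine ⟨fun m hm => BB.isCondExp_iff_eq_condExp (hinj m hm), ?_⟩
  -- Two levels are needed: `ε_{m+1}` defines the new trace, and `ε_m` enters the symmetry of `ψ` on
  -- `BB_{m+1}`.
  obtain ⟨m, rfl⟩ : ∃ m, n = m + 1 := ⟨n - 1, by omega⟩
  exact BB.isTrace_tr_succ (hinj m m.le_succ) (hinj (m + 1) le_rfl) htr
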